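/- Let $A=\mathbb C\langle x_1,\dots,x_m\rangle$ be the free associative algebra. A linear map $\{\!\{\,,\}\!\}\colon A\otimes A\to A\otimes A$ is a double Poisson bracket if for all $a,b,c\in A$ $$\{\!\{a,b\}\!\}=-\{\!\{b,a\}\!\}^{op},\qquad \{\!\{ab,c\}\!\}=(1\otimes a)\{\!\{b,c\}\!\}+\{\!\{a,c\}\!\}(b\otimes 1),\qquad \{\!\{a,bc\}\!\}=(b\otimes 1)\{\!\{a,c\}\!\}+\{\!\{a,b\}\!\}(1\otimes c),$$ and $R_{12}R_{23}+R_{31}R_{12}+R_{23}R_{31}=0$ on $A\otimes A\otimes A$, where $R_{ij}$ replaces the $i$-th and $j$-th tensor factors $a_i,a_j$ by the first and second components of $\{\!\{a_i,a_j\}\!\}$ respectively. It is quadratic if there are complex tensors $r,a$ with $r^{\sigma\epsilon}_{\alpha\beta}=-r^{\epsilon\sigma}_{\beta\alpha}$ such that for all $\alpha,\beta$ (summing over $p,q$) $$\{\!\{x_\alpha,x_\beta\}\!\}=r^{pq}_{\alpha\beta}\,x_p\otimes x_q+a^{qp}_{\alpha\beta}\,x_px_q\otimes 1-a^{pq}_{\beta\alpha}\,1\otimes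 x_qx_p .\qquad(*)$$ Two brackets are equivalent under a linear change of generators if one is carried to the other by $\varphi\otimes\varphi$ for an automorphism $\varphi(x_i)=\sum_j g_{ij}x_j$ of $A$, $g\in GL_m(\mathbb C)$. Theorem. Let $m=2$, $u=x_1$, $v=x_2$. For each of the following seven choices of tensors (all components not listed are zero) there is exactly one double Poisson bracket on $\mathbb C\langle u,v\rangle$ satisfying $(*)$; it is quadratic and nonzero, and its nonzero values on the generators are the ones listed. Case 1. $r^{21}_{22}=-r^{12}_{22}=1$: $\{\!\{v,v\}\!\}=v\otimes u-u\otimes v$. Case 2. $r^{21}_{22}=-r^{12}_{22}=1$, $a^{11}_{21}=a^{12}_{22}=1$: $\{\!\{v,v\}\!\}=v\otimes u-u\otimes v+vu\otimes 1-1\otimes vu$, $\{\!\{v,u\}\!\}=u^2\otimes 1$, $\{\!\{u,v\}\!\}=-1\otimes u^2$. Case 3. $r^{21}_{22}=-r^{12}_{22}=1$, $a^{11}_{12}=a^{21}_{22}=1$: $\{\!\{v,v\}\!\}=v\otimes u-u\otimes v+uv\otimes 1-1\otimes uv$, $\{\!\{u,v\}\!\}=u^2\otimes 1$, $\{\!\{v,u\}\!\}=-1\otimes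 u^2$. Case 4. $r^{22}_{21}=-r^{22}_{12}=1$: $\{\!\{v,u\}\!\}=v\otimes v$, $\{\!\{u,v\}\!\}=-v\otimes v$. Case 5. $r^{22}_{21}=-r^{22}_{12}=1$, $a^{21}_{11}=a^{22}_{12}=1$: $\{\!\{v,u\}\!\}=v\otimes v-1\otimes v^2$, $\{\!\{u,v\}\!\}=-v\otimes v+v^2\otimes 1$, $\{\!\{u,u\}\!\}=uv\otimes 1-1\otimes uv$. Case 6. $r^{22}_{21}=-r^{22}_{12}=1$, $a^{12}_{11}=a^{22}_{21}=-1$: $\{\!\{v,u\}\!\}=v\otimes v-v^2\otimes 1$, $\{\!\{u,v\}\!\}=-v\otimes v+1\otimes v^2$, $\{\!\{u,u\}\!\}=-vu\otimes 1+1\otimes vu$. Case 7. $a^{11}_{22}=1$: $\{\!\{v,v\}\!\}=u^2\otimes 1-1\otimes u^2$. Every nonzero quadratic double Poisson bracket on $\mathbb C\langle u,v\rangle$ is equivalent, under a linear change of the generators, to the bracket of exactly one of the Cases 1-7. -/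

import Mathlib

open scoped TensorProduct

noncomputable section

namespace DoublePoisson

section General

variable {k A : Type*} [CommRing k] [Ring A] [Algebra k A]

/-- The operator `R₂₃`: `a ⊗ b ⊗ c ↦ a ⊗ ⦃b, c⦄' ⊗ ⦃b, c⦄''`. -/
def opR23 (B : A ⊗[k] A →ₗ[k] A ⊗[k] A) :
    A ⊗[k] (A ⊗[k] A) →ₗ[k] A ⊗[k] (A ⊗[k] A) :=
  LinearMap.lTensor A B

/-- The operator `R₁₂`: `a ⊗ b ⊗ c ↦ ⦃a, b⦄' ⊗ ⦃a, b⦄'' ⊗ c`. -/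
def opR12 (B : A ⊗[k] A →ₗ[k] A ⊗[k] A) :
    A ⊗[k] (A ⊗[k] A) →ₗ[k] A ⊗[k] (A ⊗[k] A) :=
  (TensorProduct.assoc k A A A).toLinearMap ∘ₗ LinearMap.rTensor A B ∘ₗ
    (TensorProduct.assoc k A A A).symm.toLinearMap

/-- The cyclic permutation `a ⊗ b ⊗ c ↦ c ⊗ a ⊗ b` of the tensor factors. -/
def cyc : A ⊗[k] (A ⊗[k] A) ≃ₗ[k] A ⊗[k] (A ⊗[k] A) :=
  (TensorProduct.assoc k A A A).symm.trans (TensorProduct.comm k (A ⊗[k] A) A)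

/-- The operator `R₃₁`: `a ⊗ b ⊗ c ↦ ⦃c, a⦄'' ⊗ b ⊗ ⦃c, a⦄'`. -/
def opR31 (B : A ⊗[k] A →ₗ[k] A ⊗[k] A) :
    A ⊗[k] (A ⊗[k] A) →ₗ[k] A ⊗[k] (A ⊗[k] A) :=
  (cyc (k := k) (A := A)).symm.toLinearMap ∘ₗ opR12 B ∘ₗ (cyc (k := k) (A := A)).toLinearMap

theorem opR12_tmul (B : A ⊗[k] A →ₗ[k] A ⊗[k] A) (a b c : A) :
    opR12 B (a ⊗ₜ[k] (b ⊗ₜ[k] c)) =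
      TensorProduct.assoc k A A A (B (a ⊗ₜ[k] b) ⊗ₜ[k] c) := rfl

theorem opR23_tmul (B : A ⊗[k] A →ₗ[k] A ⊗[k] A) (a b c : A) :
    opR23 B (a ⊗ₜ[k] (b ⊗ₜ[k] c)) = a ⊗ₜ[k] B (b ⊗ₜ[k] c) := rfl

theorem cyc_tmul (a b c : A) :
    cyc (a ⊗ₜ[k] (b ⊗ₜ[k] c)) = c ⊗ₜ[k] (a ⊗ₜ[k] b) := rfl

theorem cyc_symm_tmul (a b c : A) :
    cyc.symm (a ⊗ₜ[k] (b ⊗ₜ[k] c)) = b ⊗ₜ[k] (c ⊗ₜ[k] a) := rfl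

/-- A double Poisson bracket on an associative algebra `A`. -/
structure IsDoublePoisson (B : A ⊗[k] A →ₗ[k] A ⊗[k] A) : Prop where
  skew : ∀ a b : A, B (a ⊗ₜ[k] b) = -TensorProduct.comm k A A (B (b ⊗ₜ[k] a))
  mul_left : ∀ a b c : A,
    B ((a * b) ⊗ₜ[k] c) =
      ((1 : A) ⊗ₜ[k] a) * B (b ⊗ₜ[k] c) + B (a ⊗ₜ[k] c) * (b ⊗ₜ[k] (1 : A))
  mul_right : ∀ a b c : A,
    B (a ⊗ₜ[k] (b * c)) =
      (b ⊗ₜ[k] (1 : A)) * B (a ⊗ₜ[k] c) + B (a ⊗ₜ[k] b) * ((1 : A) ⊗ₜ[k] c)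
  jacobi : opR12 B ∘ₗ opR23 B + opR31 B ∘ₗ opR12 B + opR23 B ∘ₗ opR31 B = 0

end General

/-- The free associative algebra `ℂ⟨x₁, …, xₘ⟩`. -/
abbrev Free (m : ℕ) : Type := FreeAlgebra ℂ (Fin m)

/-- The generators of the free algebra (numbered from `0`). -/
abbrev gen {m : ℕ} (i : Fin m) : Free m := FreeAlgebra.ι ℂ i

/-- A bracket on the free algebra, as a linear map `A ⊗ A → A ⊗ A`. -/
abbrev Bracket (m : ℕ) : Type := Free m ⊗[ℂ] Free m →ₗ[ℂ] Free m ⊗[ℂ] Free m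

/-- Tensors with two upper and two lower indices: `t σ ε α β` is the component with upper
indices `σ, ε` and lower indices `α, β`. -/
abbrev Tensor22 (m : ℕ) : Type := Fin m → Fin m → Fin m → Fin m → ℂ

/-- The skew-symmetry `r^{σ ε}_{α β} = - r^{ε σ}_{β α}`. -/
def IsSkew {m : ℕ} (r : Tensor22 m) : Prop :=
  ∀ σ ε α β, r σ ε α β = -r ε σ β α

/-- The values of `B` on the generators are the quadratic expressions with coefficients
`r` and `a`. -/
def HasTensors {m : ℕ} (B : Bracket m) (r a : Tensor22 m) : Prop :=
  ∀ α β : Fin m,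
    B (gen α ⊗ₜ[ℂ] gen β) =
      ∑ p : Fin m, ∑ q : Fin m,
        (r p q α β • (gen p ⊗ₜ[ℂ] gen q)
          + a q p α β • ((gen p * gen q) ⊗ₜ[ℂ] (1 : Free m))
          - a p q β α • ((1 : Free m) ⊗ₜ[ℂ] (gen q * gen p)))

/-- Quadratic brackets. -/
def IsQuadratic {m : ℕ} (B : Bracket m) : Prop :=
  ∃ r a : Tensor22 m, IsSkew r ∧ HasTensors B r a

/-- The endomorphism of the free algebra with `xᵢ ↦ ∑ⱼ gᵢⱼ xⱼ`
(an automorphism, since `g` is invertible). -/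
def linearChange {m : ℕ} (g : GL (Fin m) ℂ) : Free m →ₐ[ℂ] Free m :=
  FreeAlgebra.lift ℂ fun i => ∑ j, (g : Matrix (Fin m) (Fin m) ℂ) i j • gen j

/-- Equivalence of brackets under a linear change of generators:
`⦃φ a, φ b⦄₂ = (φ ⊗ φ) ⦃a, b⦄₁` for some linear change of generators `φ`. -/
def LinEquivalent {m : ℕ} (B₁ B₂ : Bracket m) : Prop :=
  ∃ g : GL (Fin m) ℂ, ∀ a b : Free m,
    B₂ (linearChange g a ⊗ₜ[ℂ] linearChange g b) =
      TensorProduct.map (linearChange g).toLinearMap (linearChange g).toLinearMap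
        (B₁ (a ⊗ₜ[ℂ] b))

/-- The tensor whose only nonzero component is a `1` at upper indices `σ, ε` and lower
indices `α, β`. -/
def unitTensor {m : ℕ} (σ ε α β : Fin m) : Tensor22 m :=
  fun s e x y => if s = σ ∧ e = ε ∧ x = α ∧ y = β then 1 else 0

/-- The tensors `r` of the Cases 1 to 7 (cases and indices are numbered from `0` here). -/
def caseR : Fin 7 → Tensor22 2 :=
  ![unitTensor 1 0 1 1 - unitTensor 0 1 1 1,
    unitTensor 1 0 1 1 - unitTensor 0 1 1 1,
    unitTensor 1 0 1 1 - unitTensor 0 1 1 1,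
    unitTensor 1 1 1 0 - unitTensor 1 1 0 1,
    unitTensor 1 1 1 0 - unitTensor 1 1 0 1,
    unitTensor 1 1 1 0 - unitTensor 1 1 0 1,
    0]

/-- The tensors `a` of the Cases 1 to 7. -/
def caseA : Fin 7 → Tensor22 2 :=
  ![0,
    unitTensor 0 0 1 0 + unitTensor 0 1 1 1,
    unitTensor 0 0 0 1 + unitTensor 1 0 1 1,
    0,
    unitTensor 1 0 0 0 + unitTensor 1 1 0 1,
    -unitTensor 0 1 0 0 - unitTensor 1 1 1 0,
    unitTensor 0 0 1 1]

/-- The generator `u = x₁`. -/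
abbrev u : Free 2 := gen 0

/-- The generator `v = x₂`. -/
abbrev v : Free 2 := gen 1

/-- The explicit double brackets between the generators in the Cases 1 to 7, as matrices with
rows `⦃u, u⦄, ⦃u, v⦄` and `⦃v, u⦄, ⦃v, v⦄`. -/
def caseValue : Fin 7 → Matrix (Fin 2) (Fin 2) (Free 2 ⊗[ℂ] Free 2) :=
  ![!![0, 0;
       0, v ⊗ₜ u - u ⊗ₜ v],
    !![0, -(1 ⊗ₜ (u * u));
       (u * u) ⊗ₜ 1, v ⊗ₜ u - u ⊗ₜ v + (v * u) ⊗ₜ 1 - 1 ⊗ₜ (v * u)],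
    !![0, (u * u) ⊗ₜ 1;
       -(1 ⊗ₜ (u * u)), v ⊗ₜ u - u ⊗ₜ v + (u * v) ⊗ₜ 1 - 1 ⊗ₜ (u * v)],
    !![0, -(v ⊗ₜ v);
       v ⊗ₜ v, 0],
    !![(u * v) ⊗ₜ 1 - 1 ⊗ₜ (u * v), -(v ⊗ₜ v) + (v * v) ⊗ₜ 1;
       v ⊗ₜ v - 1 ⊗ₜ (v * v), 0],
    !![-((v * u) ⊗ₜ 1) + 1 ⊗ₜ (v * u), -(v ⊗ₜ v) + 1 ⊗ₜ (v * v);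
       v ⊗ₜ v - (v * v) ⊗ₜ 1, 0],
    !![0, 0;
       0, (u * u) ⊗ₜ 1 - 1 ⊗ₜ (u * u)]]

end DoublePoisson

end

/-!
A double bracket on a free algebra is determined by its values on the generators, and these values
can be any skew-symmetric family (`exists_isDoubleBracket`, `IsDoubleBracket.ext_generators`). The
Jacobiator `R₁₂R₂₃ + R₃₁R₁₂ + R₂₃R₃₁` commutes with the cyclic permutation and is a derivation in
its last argument (`IsDoubleBracket.jacobiator_mul`), so that the Jacobi identity has to be checked
on generators only. For the seven cases this is a finite computation
(`IsDoubleBracket.jacobiator_case`), which gives existence and uniqueness.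

For the classification, the coefficients of words in the Jacobiator of three generators give
quadratic equations on the tensors `r` and `a` (`TensorEquations`), and a change of generators acts
on `r` and `a` by the change of basis (`exists_transport`). In two variables the equation on `r`
alone forces `r` to be symmetric in one pair of indices and skew-symmetric in the other, with a
symmetric matrix of determinant zero, hence of rank at most one (`TensorEquations.r_cases`). So a
nonzero `r` is, in suitable generators, `E₂₂ ∧ E₁₂` or `E₂₂ ∧ E₂₁` up to sign, where `Eᵢⱼ` are the
matrix units. For each of these two, the remaining equations have exactly three solutions `a`,
which are isolated: zero and one tensor of each of the forms `N ⊗ 1` and `1 ⊗ N` up to sign, with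
the nilpotent `N = E₁₂` or `N = E₂₁` (`TensorEquations.eq_caseA_of_caseR_zero` and
`TensorEquations.eq_caseA_of_caseR_three`). These are Cases 1 to 6. If `r = 0`, then `a` is a
multiple of `N ⊗ N` with `N` nilpotent, which is Case 7 after scaling.

The cases are inequivalent because the following do not depend on the generators: whether `r`
vanishes, whether `r` is symmetric in its upper indices, and whether each of the two contractions
of `a` vanishes (`case_injective`).
-/

noncomputable section

namespace DoublePoisson

/-! ### Double brackets and their Jacobiator -/

section Jacobiator

variable {k A : Type*} [CommRing k] [Ring A] [Algebra k A]

/-- A double bracket: skew-symmetric and a derivation in both arguments, but not necessarily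
subject to the Jacobi identity. -/
structure IsDoubleBracket (B : A ⊗[k] A →ₗ[k] A ⊗[k] A) : Prop where
  skew : ∀ a b : A, B (a ⊗ₜ[k] b) = -TensorProduct.comm k A A (B (b ⊗ₜ[k] a))
  mul_left : ∀ a b c : A,
    B ((a * b) ⊗ₜ[k] c) =
      ((1 : A) ⊗ₜ[k] a) * B (b ⊗ₜ[k] c) + B (a ⊗ₜ[k] c) * (b ⊗ₜ[k] (1 : A))
  mul_right : ∀ a b c : A,
    B (a ⊗ₜ[k] (b * c)) =
      (b ⊗ₜ[k] (1 : A)) * B (a ⊗ₜ[k] c) + B (a ⊗ₜ[k] b) * ((1 : A) ⊗ₜ[k] c)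

theorem IsDoublePoisson.isDoubleBracket {B : A ⊗[k] A →ₗ[k] A ⊗[k] A}
    (hB : IsDoublePoisson B) : IsDoubleBracket B :=
  ⟨hB.skew, hB.mul_left, hB.mul_right⟩

theorem IsDoubleBracket.apply_one_right {B : A ⊗[k] A →ₗ[k] A ⊗[k] A}
    (hB : IsDoubleBracket B) (a : A) : B (a ⊗ₜ[k] (1 : A)) = 0 := by
  have h := hB.mul_right a 1 1
  rw [mul_one, ← Algebra.TensorProduct.one_def, one_mul, mul_one] at h
  simpa using h

theorem IsDoubleBracket.apply_one_left {B : A ⊗[k] A →ₗ[k] A ⊗[k] A}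
    (hB : IsDoubleBracket B) (a : A) : B ((1 : A) ⊗ₜ[k] a) = 0 := by
  rw [hB.skew, hB.apply_one_right, map_zero, neg_zero]

theorem IsDoubleBracket.apply_algebraMap_right {B : A ⊗[k] A →ₗ[k] A ⊗[k] A}
    (hB : IsDoubleBracket B) (a : A) (c : k) : B (a ⊗ₜ[k] algebraMap k A c) = 0 := by
  rw [Algebra.algebraMap_eq_smul_one, TensorProduct.tmul_smul, map_smul, hB.apply_one_right,
    smul_zero]

theorem IsDoubleBracket.apply_algebraMap_left {B : A ⊗[k] A →ₗ[k] A ⊗[k] A}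
    (hB : IsDoubleBracket B) (a : A) (c : k) : B (algebraMap k A c ⊗ₜ[k] a) = 0 := by
  rw [Algebra.algebraMap_eq_smul_one, TensorProduct.smul_tmul, TensorProduct.tmul_smul, map_smul,
    hB.apply_one_left, smul_zero]

/-- The operator `R₁₂R₂₃ + R₃₁R₁₂ + R₂₃R₃₁` whose vanishing is the double Jacobi identity. -/
def jacobiator (B : A ⊗[k] A →ₗ[k] A ⊗[k] A) :
    A ⊗[k] (A ⊗[k] A) →ₗ[k] A ⊗[k] (A ⊗[k] A) :=
  opR12 B ∘ₗ opR23 B + opR31 B ∘ₗ opR12 B + opR23 B ∘ₗ opR31 B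

theorem cyc_cyc_cyc (t : A ⊗[k] (A ⊗[k] A)) : cyc (cyc (cyc t)) = t := by
  have h : (cyc (k := k) (A := A)).toLinearMap ∘ₗ cyc.toLinearMap ∘ₗ cyc.toLinearMap =
      LinearMap.id := by
    ext a b c
    rfl
  exact LinearMap.congr_fun h t

theorem cyc_symm_eq (t : A ⊗[k] (A ⊗[k] A)) : cyc.symm t = cyc (cyc t) := by
  rw [LinearEquiv.symm_apply_eq, cyc_cyc_cyc]

theorem cyc_opR12 (B : A ⊗[k] A →ₗ[k] A ⊗[k] A) (t : A ⊗[k] (A ⊗[k] A)) :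
    cyc (opR12 B t) = opR23 B (cyc t) := by
  have h : (cyc (k := k) (A := A)).toLinearMap ∘ₗ opR12 B = opR23 B ∘ₗ cyc.toLinearMap := by
    ext a b c
    simp only [TensorProduct.AlgebraTensorModule.curry_apply, TensorProduct.curry_apply,
      LinearMap.restrictScalars_self, LinearMap.coe_comp, LinearEquiv.coe_coe,
      Function.comp_apply, opR12_tmul, cyc_tmul, opR23_tmul]
    simp [cyc]
  exact LinearMap.congr_fun h t

/-- The three terms of the Jacobiator are the conjugates of `R₁₂R₂₃` by the cyclic permutation. -/
theorem jacobiator_apply (B : A ⊗[k] A →ₗ[k] A ⊗[k] A) (t : A ⊗[k] (A ⊗[k] A)) :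
    jacobiator B t = opR12 B (opR23 B t) + cyc.symm (opR12 B (opR23 B (cyc t))) +
      cyc (opR12 B (opR23 B (cyc.symm t))) := by
  simp only [jacobiator, LinearMap.add_apply, LinearMap.comp_apply, opR31,
    LinearEquiv.coe_coe, cyc_opR12, cyc_symm_eq]

theorem jacobiator_cyc (B : A ⊗[k] A →ₗ[k] A ⊗[k] A) (t : A ⊗[k] (A ⊗[k] A)) :
    jacobiator B (cyc t) = cyc (jacobiator B t) := by
  simp only [jacobiator_apply, map_add, cyc_symm_eq, cyc_cyc_cyc]
  abel

theorem cyc_mul (s t : A ⊗[k] (A ⊗[k] A)) : cyc (s * t) = cyc s * cyc t := by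
  induction s with
  | zero => simp
  | add x y hx hy => simp only [add_mul, map_add, hx, hy]
  | tmul a y =>
    induction y with
    | zero => simp
    | add x y hx hy => simp only [TensorProduct.tmul_add, add_mul, map_add, hx, hy]
    | tmul b c =>
      induction t with
      | zero => simp
      | add x y hx hy => simp only [mul_add, map_add, hx, hy]
      | tmul a' y =>
        induction y with
        | zero => simp
        | add x y hx hy => simp only [TensorProduct.tmul_add, mul_add, map_add, hx, hy]
        | tmul b' c' => simp only [Algebra.TensorProduct.tmul_mul_tmul, cyc_tmul]

theorem cyc_symm_mul (s t : A ⊗[k] (A ⊗[k] A)) :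
    cyc.symm (s * t) = cyc.symm s * cyc.symm t := by
  simp only [cyc_symm_eq, cyc_mul]

theorem assoc_mul (s t : (A ⊗[k] A) ⊗[k] A) :
    TensorProduct.assoc k A A A (s * t) =
      TensorProduct.assoc k A A A s * TensorProduct.assoc k A A A t :=
  map_mul (Algebra.TensorProduct.assoc k k k A A A) s t

variable {B : A ⊗[k] A →ₗ[k] A ⊗[k] A}

theorem IsDoubleBracket.opR12_mul_left (hB : IsDoubleBracket B) (c d : A) (Y : A ⊗[k] A) :
    opR12 B ((c * d) ⊗ₜ[k] Y) =
      ((1 : A) ⊗ₜ[k] (c ⊗ₜ[k] (1 : A))) * opR12 B (d ⊗ₜ[k] Y) +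
        opR12 B (c ⊗ₜ[k] Y) * (d ⊗ₜ[k] ((1 : A) ⊗ₜ[k] (1 : A))) := by
  induction Y with
  | zero => simp
  | add x y hx hy => simp only [TensorProduct.tmul_add, map_add, hx, hy, mul_add, add_mul]; abel
  | tmul y z =>
    have h1 : (1 : A) ⊗ₜ[k] (c ⊗ₜ[k] (1 : A)) =
      TensorProduct.assoc k A A A (((1 : A) ⊗ₜ[k] c) ⊗ₜ[k] (1 : A)) := rfl
    have h2 : d ⊗ₜ[k] ((1 : A) ⊗ₜ[k] (1 : A)) =
      TensorProduct.assoc k A A A ((d ⊗ₜ[k] (1 : A)) ⊗ₜ[k] (1 : A)) := rfl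
    simp only [opR12_tmul, hB.mul_left, h1, h2, ← assoc_mul, ← map_add,
      Algebra.TensorProduct.tmul_mul_tmul, one_mul, mul_one, TensorProduct.add_tmul]

theorem IsDoubleBracket.opR12_mul_middle (hB : IsDoubleBracket B) (a c : A) (X : A ⊗[k] A) :
    opR12 B (a ⊗ₜ[k] ((c ⊗ₜ[k] (1 : A)) * X)) =
      (c ⊗ₜ[k] ((1 : A) ⊗ₜ[k] (1 : A))) * opR12 B (a ⊗ₜ[k] X) +
        TensorProduct.assoc k A A A (B (a ⊗ₜ[k] c) ⊗ₜ[k] (1 : A)) * ((1 : A) ⊗ₜ[k] X) := by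
  induction X with
  | zero => simp
  | add x y hx hy => simp only [TensorProduct.tmul_add, map_add, hx, hy, mul_add]; abel
  | tmul y z =>
    have h1 : c ⊗ₜ[k] ((1 : A) ⊗ₜ[k] (1 : A)) =
      TensorProduct.assoc k A A A ((c ⊗ₜ[k] (1 : A)) ⊗ₜ[k] (1 : A)) := rfl
    have h2 : (1 : A) ⊗ₜ[k] (y ⊗ₜ[k] z) =
      TensorProduct.assoc k A A A (((1 : A) ⊗ₜ[k] y) ⊗ₜ[k] z) := rfl
    simp only [Algebra.TensorProduct.tmul_mul_tmul, opR12_tmul, hB.mul_right, h1, h2,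
      ← assoc_mul, ← map_add, one_mul, TensorProduct.add_tmul]

theorem opR12_mul_right_last (B : A ⊗[k] A →ₗ[k] A ⊗[k] A) (a d : A) (X : A ⊗[k] A) :
    opR12 B (a ⊗ₜ[k] (X * ((1 : A) ⊗ₜ[k] d))) =
      opR12 B (a ⊗ₜ[k] X) * ((1 : A) ⊗ₜ[k] ((1 : A) ⊗ₜ[k] d)) := by
  induction X with
  | zero => simp
  | add x y hx hy => simp only [TensorProduct.tmul_add, map_add, hx, hy, add_mul]
  | tmul y z =>
    have h1 : (1 : A) ⊗ₜ[k] ((1 : A) ⊗ₜ[k] d) =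
      TensorProduct.assoc k A A A (((1 : A) ⊗ₜ[k] (1 : A)) ⊗ₜ[k] d) := rfl
    simp only [Algebra.TensorProduct.tmul_mul_tmul, opR12_tmul, h1, ← assoc_mul, mul_one,
      ← Algebra.TensorProduct.one_def]

theorem opR12_mul_left_last (B : A ⊗[k] A →ₗ[k] A ⊗[k] A) (a d : A) (X : A ⊗[k] A) :
    opR12 B (a ⊗ₜ[k] (((1 : A) ⊗ₜ[k] d) * X)) =
      ((1 : A) ⊗ₜ[k] ((1 : A) ⊗ₜ[k] d)) * opR12 B (a ⊗ₜ[k] X) := by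
  induction X with
  | zero => simp
  | add x y hx hy => simp only [TensorProduct.tmul_add, map_add, hx, hy, mul_add]
  | tmul y z =>
    have h1 : (1 : A) ⊗ₜ[k] ((1 : A) ⊗ₜ[k] d) =
      TensorProduct.assoc k A A A (((1 : A) ⊗ₜ[k] (1 : A)) ⊗ₜ[k] d) := rfl
    simp only [Algebra.TensorProduct.tmul_mul_tmul, opR12_tmul, h1, ← assoc_mul, one_mul,
      ← Algebra.TensorProduct.one_def]

theorem IsDoubleBracket.cyc_opR12_mul_right (hB : IsDoubleBracket B) (b d : A)
    (X : A ⊗[k] A) :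
    cyc (opR12 B (b ⊗ₜ[k] (X * (d ⊗ₜ[k] (1 : A))))) =
      cyc (opR12 B (b ⊗ₜ[k] X)) * ((1 : A) ⊗ₜ[k] ((1 : A) ⊗ₜ[k] d)) +
        TensorProduct.assoc k A A A (TensorProduct.comm k A A X ⊗ₜ[k] (1 : A)) *
          ((1 : A) ⊗ₜ[k] B (b ⊗ₜ[k] d)) := by
  induction X with
  | zero => simp
  | add x y hx hy =>
    simp only [TensorProduct.tmul_add, TensorProduct.add_tmul, map_add, hx, hy, add_mul]; abel
  | tmul y z =>
    have h1 : (1 : A) ⊗ₜ[k] ((1 : A) ⊗ₜ[k] d) =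
      cyc (TensorProduct.assoc k A A A (((1 : A) ⊗ₜ[k] d) ⊗ₜ[k] (1 : A))) := rfl
    have h2 : TensorProduct.assoc k A A A
          (TensorProduct.comm k A A (y ⊗ₜ[k] z) ⊗ₜ[k] (1 : A)) =
        cyc (TensorProduct.assoc k A A A ((y ⊗ₜ[k] (1 : A)) ⊗ₜ[k] z)) := rfl
    have h3 (W : A ⊗[k] A) : (1 : A) ⊗ₜ[k] W =
        cyc (TensorProduct.assoc k A A A (W ⊗ₜ[k] (1 : A))) := by
      simp [cyc]
    rw [h2, h1, h3]
    simp only [Algebra.TensorProduct.tmul_mul_tmul, opR12_tmul, hB.mul_right,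
      ← assoc_mul, ← cyc_mul, ← map_add, mul_one, TensorProduct.add_tmul]
    rw [add_comm]

/-- The Jacobiator of a double bracket is a derivation in its last argument: the two terms that
spoil this in `R₁₂R₂₃` and in `R₂₃R₃₁` cancel by skew-symmetry. -/
theorem IsDoubleBracket.jacobiator_mul (hB : IsDoubleBracket B) (a b c d : A) :
    jacobiator B (a ⊗ₜ[k] (b ⊗ₜ[k] (c * d))) =
      (c ⊗ₜ[k] ((1 : A) ⊗ₜ[k] (1 : A))) * jacobiator B (a ⊗ₜ[k] (b ⊗ₜ[k] d)) +
        jacobiator B (a ⊗ₜ[k] (b ⊗ₜ[k] c)) * ((1 : A) ⊗ₜ[k] ((1 : A) ⊗ₜ[k] d)) := by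
  have h1 : opR12 B (opR23 B (a ⊗ₜ[k] (b ⊗ₜ[k] (c * d)))) =
      (c ⊗ₜ[k] ((1 : A) ⊗ₜ[k] (1 : A))) * opR12 B (opR23 B (a ⊗ₜ[k] (b ⊗ₜ[k] d))) +
      TensorProduct.assoc k A A A (B (a ⊗ₜ[k] c) ⊗ₜ[k] (1 : A)) *
        ((1 : A) ⊗ₜ[k] B (b ⊗ₜ[k] d)) +
      opR12 B (opR23 B (a ⊗ₜ[k] (b ⊗ₜ[k] c))) * ((1 : A) ⊗ₜ[k] ((1 : A) ⊗ₜ[k] d)) := by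
    simp only [opR23_tmul, hB.mul_right, TensorProduct.tmul_add, map_add, hB.opR12_mul_middle,
      opR12_mul_right_last]
  have h2 : cyc.symm (opR12 B (opR23 B (cyc (a ⊗ₜ[k] (b ⊗ₜ[k] (c * d)))))) =
      (c ⊗ₜ[k] ((1 : A) ⊗ₜ[k] (1 : A))) *
        cyc.symm (opR12 B (opR23 B (cyc (a ⊗ₜ[k] (b ⊗ₜ[k] d))))) +
      cyc.symm (opR12 B (opR23 B (cyc (a ⊗ₜ[k] (b ⊗ₜ[k] c))))) *
        ((1 : A) ⊗ₜ[k] ((1 : A) ⊗ₜ[k] d)) := by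
    simp only [cyc_tmul, opR23_tmul, hB.opR12_mul_left, map_add, cyc_symm_mul, cyc_symm_tmul]
  have h3 : cyc (opR12 B (opR23 B (cyc.symm (a ⊗ₜ[k] (b ⊗ₜ[k] (c * d)))))) =
      (c ⊗ₜ[k] ((1 : A) ⊗ₜ[k] (1 : A))) *
        cyc (opR12 B (opR23 B (cyc.symm (a ⊗ₜ[k] (b ⊗ₜ[k] d))))) +
      (cyc (opR12 B (opR23 B (cyc.symm (a ⊗ₜ[k] (b ⊗ₜ[k] c))))) *
        ((1 : A) ⊗ₜ[k] ((1 : A) ⊗ₜ[k] d)) +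
      TensorProduct.assoc k A A A
        (TensorProduct.comm k A A (B (c ⊗ₜ[k] a)) ⊗ₜ[k] (1 : A)) *
        ((1 : A) ⊗ₜ[k] B (b ⊗ₜ[k] d))) := by
    simp only [cyc_symm_tmul, opR23_tmul, hB.mul_left, TensorProduct.tmul_add, map_add,
      opR12_mul_left_last, cyc_mul, cyc_tmul, hB.cyc_opR12_mul_right]
  have h4 : TensorProduct.assoc k A A A (B (a ⊗ₜ[k] c) ⊗ₜ[k] (1 : A)) *
        ((1 : A) ⊗ₜ[k] B (b ⊗ₜ[k] d)) +
      TensorProduct.assoc k A A A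
        (TensorProduct.comm k A A (B (c ⊗ₜ[k] a)) ⊗ₜ[k] (1 : A)) *
        ((1 : A) ⊗ₜ[k] B (b ⊗ₜ[k] d)) = 0 := by
    rw [← add_mul, ← map_add, ← TensorProduct.add_tmul, hB.skew a c, neg_add_cancel,
      TensorProduct.zero_tmul, map_zero, zero_mul]
  rw [jacobiator_apply, h1, h2, h3]
  simp only [jacobiator_apply, mul_add, add_mul]
  rw [← sub_eq_zero, ← h4]
  abel

theorem IsDoubleBracket.jacobiator_one (hB : IsDoubleBracket B) (a b : A) :
    jacobiator B (a ⊗ₜ[k] (b ⊗ₜ[k] (1 : A))) = 0 := by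
  have h := hB.jacobiator_mul a b 1 1
  rw [mul_one, ← Algebra.TensorProduct.one_def, ← Algebra.TensorProduct.one_def, one_mul,
    mul_one] at h
  simpa using h

end Jacobiator

/-! ### Double brackets on free algebras -/

section FreeAlgebra

variable {k X : Type*} [CommRing k]

/-- The Jacobi identity on a free algebra only has to be checked on the generators. -/
theorem IsDoubleBracket.jacobiator_eq_zero
    {B : FreeAlgebra k X ⊗[k] FreeAlgebra k X →ₗ[k] FreeAlgebra k X ⊗[k] FreeAlgebra k X}
    (hB : IsDoubleBracket B)
    (h : ∀ i j l : X, jacobiator B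
      (FreeAlgebra.ι k i ⊗ₜ[k] (FreeAlgebra.ι k j ⊗ₜ[k] FreeAlgebra.ι k l)) = 0) :
    jacobiator B = 0 := by
  have step (a b : FreeAlgebra k X)
      (hab : ∀ l, jacobiator B (a ⊗ₜ[k] (b ⊗ₜ[k] FreeAlgebra.ι k l)) = 0)
      (c : FreeAlgebra k X) : jacobiator B (a ⊗ₜ[k] (b ⊗ₜ[k] c)) = 0 := by
    induction c with
    | grade0 r =>
      rw [Algebra.algebraMap_eq_smul_one, TensorProduct.tmul_smul, TensorProduct.tmul_smul,
        map_smul, hB.jacobiator_one, smul_zero]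
    | grade1 l => exact hab l
    | mul c d hc hd => rw [hB.jacobiator_mul, hc, hd, mul_zero, zero_mul, add_zero]
    | add c d hc hd => rw [TensorProduct.tmul_add, TensorProduct.tmul_add, map_add, hc, hd, add_zero]
  have rot (a b c : FreeAlgebra k X) (habc : jacobiator B (a ⊗ₜ[k] (b ⊗ₜ[k] c)) = 0) :
      jacobiator B (c ⊗ₜ[k] (a ⊗ₜ[k] b)) = 0 := by
    rw [← cyc_tmul, jacobiator_cyc, habc, map_zero]
  have h1 (i j : X) (c : FreeAlgebra k X) := step _ _ (h i j) c
  have h2 (c : FreeAlgebra k X) (i : X) (d : FreeAlgebra k X) :=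
    step c (FreeAlgebra.ι k i) (fun j => rot _ _ _ (h1 i j c)) d
  ext a b c
  exact step a b (fun l => rot _ _ _ (h2 b l a)) c

/-- An algebra homomorphism out of a free algebra that intertwines two double brackets on the
generators intertwines them everywhere. -/
theorem IsDoubleBracket.map_apply_of_generators {C : Type*} [Ring C] [Algebra k C]
    {B : FreeAlgebra k X ⊗[k] FreeAlgebra k X →ₗ[k] FreeAlgebra k X ⊗[k] FreeAlgebra k X}
    {B' : C ⊗[k] C →ₗ[k] C ⊗[k] C} (hB : IsDoubleBracket B) (hB' : IsDoubleBracket B')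
    (φ : FreeAlgebra k X →ₐ[k] C)
    (h : ∀ i j : X, B' (φ (FreeAlgebra.ι k i) ⊗ₜ[k] φ (FreeAlgebra.ι k j)) =
      Algebra.TensorProduct.map φ φ (B (FreeAlgebra.ι k i ⊗ₜ[k] FreeAlgebra.ι k j)))
    (a b : FreeAlgebra k X) :
    B' (φ a ⊗ₜ[k] φ b) = Algebra.TensorProduct.map φ φ (B (a ⊗ₜ[k] b)) := by
  have h1 (i : X) (b : FreeAlgebra k X) :
      B' (φ (FreeAlgebra.ι k i) ⊗ₜ[k] φ b) =
        Algebra.TensorProduct.map φ φ (B (FreeAlgebra.ι k i ⊗ₜ[k] b)) := by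
    induction b with
    | grade0 r =>
      rw [AlgHom.commutes, hB.apply_algebraMap_right, hB'.apply_algebraMap_right, map_zero]
    | grade1 j => exact h i j
    | mul c d hc hd =>
      rw [map_mul, hB.mul_right, hB'.mul_right, hc, hd, map_add, map_mul, map_mul,
        Algebra.TensorProduct.map_tmul, Algebra.TensorProduct.map_tmul, map_one]
    | add c d hc hd =>
      rw [map_add, TensorProduct.tmul_add, TensorProduct.tmul_add, map_add, map_add, hc, hd,
        map_add]
  induction a with
  | grade0 r =>
    rw [AlgHom.commutes, hB.apply_algebraMap_left, hB'.apply_algebraMap_left, map_zero]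
  | grade1 i => exact h1 i b
  | mul c d hc hd =>
    rw [map_mul, hB.mul_left, hB'.mul_left, hc, hd, map_add, map_mul, map_mul,
      Algebra.TensorProduct.map_tmul, Algebra.TensorProduct.map_tmul, map_one]
  | add c d hc hd =>
    rw [map_add, TensorProduct.add_tmul, TensorProduct.add_tmul, map_add, map_add, hc, hd,
      map_add]

theorem IsDoubleBracket.ext_generators
    {B B' : FreeAlgebra k X ⊗[k] FreeAlgebra k X →ₗ[k] FreeAlgebra k X ⊗[k] FreeAlgebra k X}
    (hB : IsDoubleBracket B) (hB' : IsDoubleBracket B')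
    (h : ∀ i j : X, B (FreeAlgebra.ι k i ⊗ₜ[k] FreeAlgebra.ι k j) =
      B' (FreeAlgebra.ι k i ⊗ₜ[k] FreeAlgebra.ι k j)) : B = B' := by
  refine TensorProduct.ext' fun a b => ?_
  have := hB'.map_apply_of_generators hB (AlgHom.id k _) (fun i j => ?_) a b
  · simpa using this
  · simpa using h i j

section Construction

variable {C : Type*} [Ring C] [Algebra k C]

/-- The derivation of a free algebra, with respect to two homomorphisms `l` and `r` to `C`, that
takes the prescribed values `d` on the generators: it is the upper right entry of the homomorphism
to the upper triangular matrices with `l` and `r` on the diagonal. -/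
def twistedDerivation (l r : FreeAlgebra k X →ₐ[k] C) (d : X → C) : FreeAlgebra k X →ₗ[k] C :=
  Matrix.entryLinearMap k C (0 : Fin 2) (1 : Fin 2) ∘ₗ
    (FreeAlgebra.lift k fun x =>
      !![l (FreeAlgebra.ι k x), d x; 0, r (FreeAlgebra.ι k x)]).toLinearMap

theorem lift_upperTriangular (l r : FreeAlgebra k X →ₐ[k] C) (d : X → C)
    (a : FreeAlgebra k X) :
    FreeAlgebra.lift k (fun x => !![l (FreeAlgebra.ι k x), d x; 0, r (FreeAlgebra.ι k x)]) a =
      !![l a, twistedDerivation l r d a; 0, r a] := by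
  suffices h : ∀ M : Matrix (Fin 2) (Fin 2) C, M = FreeAlgebra.lift k (fun x =>
      !![l (FreeAlgebra.ι k x), d x; 0, r (FreeAlgebra.ι k x)]) a →
      M 0 0 = l a ∧ M 1 0 = 0 ∧ M 1 1 = r a by
    obtain ⟨h1, h2, h3⟩ := h _ rfl
    ext i j
    fin_cases i <;> fin_cases j
    · exact h1
    · rfl
    · exact h2
    · exact h3
  rintro M rfl
  induction a with
  | grade0 s => simp [Matrix.algebraMap_matrix_apply]
  | grade1 i => simp
  | mul a b ha hb =>
    obtain ⟨ha1, ha2, ha3⟩ := ha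
    obtain ⟨hb1, hb2, hb3⟩ := hb
    simp only [map_mul, Matrix.mul_apply, Fin.sum_univ_two, ha1, ha2, ha3, hb1, hb2, hb3]
    simp
  | add a b ha hb =>
    obtain ⟨ha1, ha2, ha3⟩ := ha
    obtain ⟨hb1, hb2, hb3⟩ := hb
    simp [map_add, Matrix.add_apply, ha1, ha2, ha3, hb1, hb2, hb3]

@[simp]
theorem twistedDerivation_ι (l r : FreeAlgebra k X →ₐ[k] C) (d : X → C) (x : X) :
    twistedDerivation l r d (FreeAlgebra.ι k x) = d x := by
  simp [twistedDerivation]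

theorem twistedDerivation_mul (l r : FreeAlgebra k X →ₐ[k] C) (d : X → C)
    (a b : FreeAlgebra k X) :
    twistedDerivation l r d (a * b) =
      l a * twistedDerivation l r d b + twistedDerivation l r d a * r b := by
  have h := congrFun (congrFun (lift_upperTriangular l r d (a * b)) 0) 1
  rw [map_mul, lift_upperTriangular, lift_upperTriangular] at h
  simpa [Matrix.mul_apply, Fin.sum_univ_two] using h.symm

theorem twistedDerivation_algebraMap (l r : FreeAlgebra k X →ₐ[k] C) (d : X → C) (s : k) :
    twistedDerivation l r d (algebraMap k _ s) = 0 := by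
  simp [twistedDerivation, Matrix.algebraMap_matrix_apply]

theorem twistedDerivation_linear (l r : FreeAlgebra k X →ₐ[k] C) (s t : k) (d e : X → C)
    (a : FreeAlgebra k X) :
    twistedDerivation l r (s • d + t • e) a =
      s • twistedDerivation l r d a + t • twistedDerivation l r e a := by
  induction a with
  | grade0 s => simp only [twistedDerivation_algebraMap, smul_zero, add_zero]
  | grade1 i => simp
  | mul a b ha hb =>
    simp only [twistedDerivation_mul, ha, hb, mul_add, add_mul, smul_add, mul_smul_comm,
      smul_mul_assoc]
    abel
  | add a b ha hb => simp only [map_add, ha, hb, smul_add]; abel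

end Construction

variable (k X) in
/-- The homomorphism `a ↦ a ⊗ 1`. -/
abbrev inclL : FreeAlgebra k X →ₐ[k] FreeAlgebra k X ⊗[k] FreeAlgebra k X :=
  Algebra.TensorProduct.includeLeft

variable (k X) in
/-- The homomorphism `a ↦ 1 ⊗ a`. -/
abbrev inclR : FreeAlgebra k X →ₐ[k] FreeAlgebra k X ⊗[k] FreeAlgebra k X :=
  Algebra.TensorProduct.includeRight

/-- On a free algebra there is a double bracket with prescribed values on the generators, as soon
as these values are skew-symmetric. -/
theorem exists_isDoubleBracket (D : X → X → FreeAlgebra k X ⊗[k] FreeAlgebra k X)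
    (hD : ∀ i j, D i j = -TensorProduct.comm k _ _ (D j i)) :
    ∃ B : FreeAlgebra k X ⊗[k] FreeAlgebra k X →ₗ[k] FreeAlgebra k X ⊗[k] FreeAlgebra k X,
      IsDoubleBracket B ∧
        ∀ i j, B (FreeAlgebra.ι k i ⊗ₜ[k] FreeAlgebra.ι k j) = D i j := by
  -- the bracket is first extended in the second argument, then in the first
  let E (b : FreeAlgebra k X) (i : X) : FreeAlgebra k X ⊗[k] FreeAlgebra k X :=
    twistedDerivation (inclL k X) (inclR k X) (D i) b
  let F (a b : FreeAlgebra k X) : FreeAlgebra k X ⊗[k] FreeAlgebra k X :=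
    twistedDerivation (inclR k X) (inclL k X) (E b) a
  have F_lin (a : FreeAlgebra k X) (s t : k) (b c : FreeAlgebra k X) :
      F a (s • b + t • c) = s • F a b + t • F a c := by
    have : E (s • b + t • c) = s • E b + t • E c := by
      ext i; simp [E]
    simp only [F, this, twistedDerivation_linear]
  have F_mul (a b c : FreeAlgebra k X) :
      F a (b * c) = (b ⊗ₜ[k] 1) * F a c + F a b * (1 ⊗ₜ[k] c) := by
    simp only [F]
    induction a with
    | grade0 s => simp only [twistedDerivation_algebraMap, mul_zero, zero_mul, add_zero]
    | grade1 i => simp [E, twistedDerivation_mul]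
    | mul x y hx hy =>
      simp only [twistedDerivation_mul, hx, hy, mul_add, add_mul,
        Algebra.TensorProduct.includeLeft_apply, Algebra.TensorProduct.includeRight_apply]
      -- the inner and the outer bimodule structures commute
      have h1 : ((1 : FreeAlgebra k X) ⊗ₜ[k] x) * (b ⊗ₜ[k] (1 : FreeAlgebra k X)) =
          (b ⊗ₜ[k] 1) * (1 ⊗ₜ[k] x) := by simp
      have h2 : ((1 : FreeAlgebra k X) ⊗ₜ[k] c) * (y ⊗ₜ[k] (1 : FreeAlgebra k X)) =
          (y ⊗ₜ[k] 1) * (1 ⊗ₜ[k] c) := by simp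
      rw [← mul_assoc (1 ⊗ₜ[k] x) (b ⊗ₜ[k] 1), h1, mul_assoc _ (1 ⊗ₜ[k] c) (y ⊗ₜ[k] 1), h2]
      simp only [mul_assoc]
      abel
    | add x y hx hy => simp only [map_add, hx, hy, mul_add, add_mul]; abel
  let B : FreeAlgebra k X ⊗[k] FreeAlgebra k X →ₗ[k] FreeAlgebra k X ⊗[k] FreeAlgebra k X :=
    TensorProduct.lift (LinearMap.mk₂ k F (fun a a' b => map_add _ a a')
      (fun s a b => map_smul _ s a) (fun a b b' => by simpa using F_lin a 1 1 b b')
      (fun s a b => by simpa using F_lin a s 0 b 0))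
  have hBF (a b : FreeAlgebra k X) : B (a ⊗ₜ[k] b) = F a b := rfl
  have hι (i j : X) : B (FreeAlgebra.ι k i ⊗ₜ[k] FreeAlgebra.ι k j) = D i j := by
    simp [hBF, F, E]
  have mul_right (a b c : FreeAlgebra k X) : B (a ⊗ₜ[k] (b * c)) =
      (b ⊗ₜ[k] 1) * B (a ⊗ₜ[k] c) + B (a ⊗ₜ[k] b) * (1 ⊗ₜ[k] c) := F_mul a b c
  have mul_left (a b c : FreeAlgebra k X) : B ((a * b) ⊗ₜ[k] c) =
      (1 ⊗ₜ[k] a) * B (b ⊗ₜ[k] c) + B (a ⊗ₜ[k] c) * (b ⊗ₜ[k] 1) := by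
    simp only [hBF, F, twistedDerivation_mul, Algebra.TensorProduct.includeLeft_apply,
      Algebra.TensorProduct.includeRight_apply]
  have alg_left (s : k) (b : FreeAlgebra k X) : B (algebraMap k _ s ⊗ₜ[k] b) = 0 :=
    twistedDerivation_algebraMap _ _ _ s
  have alg_right (a : FreeAlgebra k X) (s : k) : B (a ⊗ₜ[k] algebraMap k _ s) = 0 := by
    have h := mul_right a 1 1
    rw [mul_one, ← Algebra.TensorProduct.one_def, one_mul, mul_one, right_eq_add] at h
    rw [Algebra.algebraMap_eq_smul_one, TensorProduct.tmul_smul, map_smul, h, smul_zero]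
  have comm_mul (s t : FreeAlgebra k X ⊗[k] FreeAlgebra k X) :
      TensorProduct.comm k _ _ (s * t) =
        TensorProduct.comm k _ _ s * TensorProduct.comm k _ _ t :=
    map_mul (Algebra.TensorProduct.comm k (FreeAlgebra k X) (FreeAlgebra k X)) s t
  have skew (a b : FreeAlgebra k X) :
      B (a ⊗ₜ[k] b) + TensorProduct.comm k _ _ (B (b ⊗ₜ[k] a)) = 0 := by
    have skew_ι (i : X) (b : FreeAlgebra k X) :
        B (FreeAlgebra.ι k i ⊗ₜ[k] b) +
          TensorProduct.comm k _ _ (B (b ⊗ₜ[k] FreeAlgebra.ι k i)) = 0 := by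
      induction b with
      | grade0 s => rw [alg_left, alg_right, map_zero, add_zero]
      | grade1 j => rw [hι, hι, hD i j, neg_add_cancel]
      | mul x y hx hy =>
        have : B (FreeAlgebra.ι k i ⊗ₜ[k] (x * y)) +
            TensorProduct.comm k _ _ (B ((x * y) ⊗ₜ[k] FreeAlgebra.ι k i)) =
          (x ⊗ₜ[k] 1) * (B (FreeAlgebra.ι k i ⊗ₜ[k] y) +
            TensorProduct.comm k _ _ (B (y ⊗ₜ[k] FreeAlgebra.ι k i))) +
          (B (FreeAlgebra.ι k i ⊗ₜ[k] x) +
            TensorProduct.comm k _ _ (B (x ⊗ₜ[k] FreeAlgebra.ι k i))) * (1 ⊗ₜ[k] y) := by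
          rw [mul_right, mul_left, map_add, comm_mul, comm_mul, TensorProduct.comm_tmul,
            TensorProduct.comm_tmul, mul_add, add_mul]
          abel
        rw [this, hx, hy, mul_zero, zero_mul, add_zero]
      | add x y hx hy =>
        rw [TensorProduct.tmul_add, TensorProduct.add_tmul, map_add, map_add, map_add,
          add_add_add_comm, hx, hy, add_zero]
    induction a with
    | grade0 s => rw [alg_left, alg_right, map_zero, add_zero]
    | grade1 i => exact skew_ι i b
    | mul x y hx hy =>
      have : B ((x * y) ⊗ₜ[k] b) + TensorProduct.comm k _ _ (B (b ⊗ₜ[k] (x * y))) =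
        (1 ⊗ₜ[k] x) * (B (y ⊗ₜ[k] b) + TensorProduct.comm k _ _ (B (b ⊗ₜ[k] y))) +
        (B (x ⊗ₜ[k] b) + TensorProduct.comm k _ _ (B (b ⊗ₜ[k] x))) * (y ⊗ₜ[k] 1) := by
        rw [mul_right, mul_left, map_add, comm_mul, comm_mul, TensorProduct.comm_tmul,
          TensorProduct.comm_tmul, mul_add, add_mul]
        abel
      rw [this, hx, hy, mul_zero, zero_mul, add_zero]
    | add x y hx hy =>
      rw [TensorProduct.tmul_add, TensorProduct.add_tmul, map_add, map_add, map_add,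
        add_add_add_comm, hx, hy, add_zero]
  exact ⟨B, ⟨fun a b => eq_neg_of_add_eq_zero_left (skew a b), mul_left, mul_right⟩, hι⟩

end FreeAlgebra

/-! ### Transport along automorphisms -/

section Transport

variable {k A : Type*} [CommRing k] [Ring A] [Algebra k A]

theorem opR23_map {B B' : A ⊗[k] A →ₗ[k] A ⊗[k] A} (f : A →ₗ[k] A)
    (h : B' ∘ₗ TensorProduct.map f f = TensorProduct.map f f ∘ₗ B)
    (t : A ⊗[k] (A ⊗[k] A)) :
    opR23 B' (TensorProduct.map f (TensorProduct.map f f) t) =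
      TensorProduct.map f (TensorProduct.map f f) (opR23 B t) := by
  have h' : opR23 B' ∘ₗ TensorProduct.map f (TensorProduct.map f f) =
      TensorProduct.map f (TensorProduct.map f f) ∘ₗ opR23 B := by
    refine TensorProduct.ext' fun a X => ?_
    exact congrArg (f a ⊗ₜ[k] ·) (LinearMap.congr_fun h X)
  exact LinearMap.congr_fun h' t

theorem cyc_map (f : A →ₗ[k] A) (t : A ⊗[k] (A ⊗[k] A)) :
    cyc (TensorProduct.map f (TensorProduct.map f f) t) =
      TensorProduct.map f (TensorProduct.map f f) (cyc t) := by
  have h : cyc.toLinearMap ∘ₗ TensorProduct.map f (TensorProduct.map f f) =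
      TensorProduct.map f (TensorProduct.map f f) ∘ₗ cyc.toLinearMap := by
    ext a b c
    rfl
  exact LinearMap.congr_fun h t

theorem jacobiator_map {B B' : A ⊗[k] A →ₗ[k] A ⊗[k] A} (f : A →ₗ[k] A)
    (h : B' ∘ₗ TensorProduct.map f f = TensorProduct.map f f ∘ₗ B)
    (t : A ⊗[k] (A ⊗[k] A)) :
    jacobiator B' (TensorProduct.map f (TensorProduct.map f f) t) =
      TensorProduct.map f (TensorProduct.map f f) (jacobiator B t) := by
  have h12 (t : A ⊗[k] (A ⊗[k] A)) :
      opR12 B' (TensorProduct.map f (TensorProduct.map f f) t) =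
        TensorProduct.map f (TensorProduct.map f f) (opR12 B t) := by
    apply cyc.injective
    rw [cyc_opR12, cyc_map, opR23_map f h, cyc_map, cyc_opR12]
  simp only [jacobiator_apply, cyc_symm_eq, cyc_map, opR23_map f h, h12, map_add]

/-- The transport of a double Poisson bracket along an automorphism. -/
theorem IsDoublePoisson.conj {B B' : A ⊗[k] A →ₗ[k] A ⊗[k] A} (hB : IsDoublePoisson B)
    (φ ψ : A →ₐ[k] A) (hφψ : ∀ a, φ (ψ a) = a)
    (h : ∀ a b, B' (φ a ⊗ₜ[k] φ b) =
      TensorProduct.map φ.toLinearMap φ.toLinearMap (B (a ⊗ₜ[k] b))) :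
    IsDoublePoisson B' := by
  have h' (a b : A) : B' (a ⊗ₜ[k] b) = Algebra.TensorProduct.map φ φ (B (ψ a ⊗ₜ[k] ψ b)) := by
    have := h (ψ a) (ψ b)
    rwa [hφψ, hφψ] at this
  refine ⟨fun a b => ?_, fun a b c => ?_, fun a b c => ?_, ?_⟩
  · have hcomm (t : A ⊗[k] A) : Algebra.TensorProduct.map φ φ (TensorProduct.comm k A A t) =
        TensorProduct.comm k A A (Algebra.TensorProduct.map φ φ t) := by
      induction t with
      | zero => simp
      | tmul x y => rfl
      | add x y hx hy => simp only [map_add, hx, hy]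
    rw [h', h', hB.skew, map_neg, hcomm]
  · rw [h', h', h', map_mul, hB.mul_left, map_add, map_mul, map_mul,
      Algebra.TensorProduct.map_tmul, Algebra.TensorProduct.map_tmul, map_one, hφψ, hφψ]
  · rw [h', h', h', map_mul, hB.mul_right, map_add, map_mul, map_mul,
      Algebra.TensorProduct.map_tmul, Algebra.TensorProduct.map_tmul, map_one, hφψ, hφψ]
  · change jacobiator B' = 0
    ext a b c
    have := jacobiator_map (B := B) (B' := B') φ.toLinearMap (TensorProduct.ext' h)
      (ψ a ⊗ₜ[k] (ψ b ⊗ₜ[k] ψ c))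
    have hJ : jacobiator B = 0 := hB.jacobi
    rw [hJ, LinearMap.zero_apply, map_zero] at this
    simpa [hφψ] using this

end Transport

/-! ### Coefficients of words and the equations on the tensors -/

/-- The coefficient of the word `w` in an element of the free algebra. -/
def wordCoeff {m : ℕ} (w : List (Fin m)) : Free m →ₗ[ℂ] ℂ :=
  Finsupp.lapply (FreeMonoid.ofList w) ∘ₗ
    (MonoidAlgebra.coeffLinearEquiv ℂ).toLinearMap ∘ₗ
      FreeAlgebra.equivMonoidAlgebraFreeMonoid.toLinearMap

theorem wordCoeff_prod {m : ℕ} (w l : List (Fin m)) :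
    wordCoeff w ((l.map gen).prod) = if l = w then 1 else 0 := by
  have h : FreeAlgebra.equivMonoidAlgebraFreeMonoid ((l.map gen).prod) =
      (MonoidAlgebra.of ℂ (FreeMonoid (Fin m)) (FreeMonoid.ofList l)) := by
    induction l with
    | nil => simp [MonoidAlgebra.one_def]
    | cons i l ih =>
      rw [List.map_cons, List.prod_cons, map_mul, ih, FreeMonoid.ofList_cons, map_mul]
      congr 1
      simp [FreeAlgebra.equivMonoidAlgebraFreeMonoid, gen]
  have h' : wordCoeff w ((l.map gen).prod) =
      (FreeAlgebra.equivMonoidAlgebraFreeMonoid ((l.map gen).prod)).coeff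
        (FreeMonoid.ofList w) := rfl
  classical
  rw [h', h, MonoidAlgebra.of_apply, MonoidAlgebra.coeff_single, Finsupp.single_apply]
  simp only [EmbeddingLike.apply_eq_iff_eq]

section wordCoeff
variable {m : ℕ} (w : List (Fin m)) (i j l : Fin m)

@[simp]
theorem wordCoeff_one : wordCoeff w (1 : Free m) = if [] = w then 1 else 0 :=
  wordCoeff_prod w []

@[simp]
theorem wordCoeff_gen : wordCoeff w (gen i) = if [i] = w then 1 else 0 := by
  simpa using wordCoeff_prod w [i]

@[simp]
theorem wordCoeff_gen_mul_gen :
    wordCoeff w (gen i * gen j) = if [i, j] = w then 1 else 0 := by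
  simpa using wordCoeff_prod w [i, j]

@[simp]
theorem wordCoeff_gen_mul_gen_mul_gen :
    wordCoeff w (gen i * (gen j * gen l)) = if [i, j, l] = w then 1 else 0 := by
  simpa using wordCoeff_prod w [i, j, l]

end wordCoeff

/-- The coefficient of `w₁ ⊗ w₂` in an element of `A ⊗ A`. -/
def wordCoeff₂ {m : ℕ} (w₁ w₂ : List (Fin m)) : Free m ⊗[ℂ] Free m →ₗ[ℂ] ℂ :=
  LinearMap.mul' ℂ ℂ ∘ₗ TensorProduct.map (wordCoeff w₁) (wordCoeff w₂)

@[simp]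
theorem wordCoeff₂_tmul {m : ℕ} (w₁ w₂ : List (Fin m)) (a b : Free m) :
    wordCoeff₂ w₁ w₂ (a ⊗ₜ[ℂ] b) = wordCoeff w₁ a * wordCoeff w₂ b := rfl

/-- The coefficient of `w₁ ⊗ w₂ ⊗ w₃` in an element of `A ⊗ A ⊗ A`. -/
def wordCoeff₃ {m : ℕ} (w₁ w₂ w₃ : List (Fin m)) :
    Free m ⊗[ℂ] (Free m ⊗[ℂ] Free m) →ₗ[ℂ] ℂ :=
  LinearMap.mul' ℂ ℂ ∘ₗ TensorProduct.map (wordCoeff w₁) (wordCoeff₂ w₂ w₃)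

theorem wordCoeff₃_assoc {m : ℕ} (w₁ w₂ w₃ : List (Fin m)) (X : Free m ⊗[ℂ] Free m)
    (c : Free m) :
    wordCoeff₃ w₁ w₂ w₃ (TensorProduct.assoc ℂ _ _ _ (X ⊗ₜ[ℂ] c)) =
      wordCoeff₂ w₁ w₂ X * wordCoeff w₃ c := by
  induction X with
  | zero => simp
  | tmul a b => exact (mul_assoc _ _ _).symm
  | add x y hx hy => rw [TensorProduct.add_tmul, map_add, map_add, map_add, hx, hy, add_mul]

theorem wordCoeff₃_cyc {m : ℕ} (w₁ w₂ w₃ : List (Fin m)) (t : Free m ⊗[ℂ] (Free m ⊗[ℂ] Free m)) :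
    wordCoeff₃ w₁ w₂ w₃ (cyc t) = wordCoeff₃ w₂ w₃ w₁ t := by
  have h : wordCoeff₃ w₁ w₂ w₃ ∘ₗ cyc.toLinearMap = wordCoeff₃ w₂ w₃ w₁ := by
    refine TensorProduct.ext_threefold' fun a b c => ?_
    change wordCoeff w₁ c * (wordCoeff w₂ a * wordCoeff w₃ b) =
      wordCoeff w₂ a * (wordCoeff w₃ b * wordCoeff w₁ c)
    ring
  exact LinearMap.congr_fun h t

theorem wordCoeff₃_cyc_symm {m : ℕ} (w₁ w₂ w₃ : List (Fin m))
    (t : Free m ⊗[ℂ] (Free m ⊗[ℂ] Free m)) :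
    wordCoeff₃ w₁ w₂ w₃ (cyc.symm t) = wordCoeff₃ w₃ w₁ w₂ t := by
  rw [cyc_symm_eq, wordCoeff₃_cyc, wordCoeff₃_cyc]

section HasTensors

variable {m : ℕ} {B : Bracket m} {r a : Tensor22 m}

theorem HasTensors.wordCoeff₂_one_one (h : HasTensors B r a) (p q α β : Fin m) :
    wordCoeff₂ [p] [q] (B (gen α ⊗ₜ[ℂ] gen β)) = r p q α β := by
  simp [h α β]

theorem HasTensors.wordCoeff₂_two_zero (h : HasTensors B r a) (p q α β : Fin m) :
    wordCoeff₂ [p, q] [] (B (gen α ⊗ₜ[ℂ] gen β)) = a q p α β := by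
  simp [h α β, ite_and]

theorem HasTensors.wordCoeff₂_zero_two (h : HasTensors B r a) (p q α β : Fin m) :
    wordCoeff₂ [] [p, q] (B (gen α ⊗ₜ[ℂ] gen β)) = - a q p β α := by
  simp [h α β, ite_and]


theorem HasTensors.apply_gen_mul_gen (h : HasTensors B r a) (hB : IsDoubleBracket B)
    (α p q : Fin m) :
    B (gen α ⊗ₜ[ℂ] (gen p * gen q)) =
      ∑ s : Fin m, ∑ t : Fin m,
        (r s t α q • ((gen p * gen s) ⊗ₜ[ℂ] gen t)
          + a t s α q • ((gen p * (gen s * gen t)) ⊗ₜ[ℂ] (1 : Free m))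
          - a s t q α • (gen p ⊗ₜ[ℂ] (gen t * gen s)))
      + ∑ s : Fin m, ∑ t : Fin m,
        (r s t α p • (gen s ⊗ₜ[ℂ] (gen t * gen q))
          + a t s α p • ((gen s * gen t) ⊗ₜ[ℂ] gen q)
          - a s t p α • ((1 : Free m) ⊗ₜ[ℂ] (gen t * (gen s * gen q)))) := by
  rw [hB.mul_right, h α q, h α p]
  simp only [Finset.mul_sum, Finset.sum_mul, mul_add, mul_sub, add_mul, sub_mul,
    mul_smul_comm, smul_mul_assoc, Algebra.TensorProduct.tmul_mul_tmul, one_mul, mul_one,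
    mul_assoc]

theorem HasTensors.wordCoeff₂_mul_three_zero (h : HasTensors B r a) (hB : IsDoubleBracket B)
    (α p q i j l : Fin m) :
    wordCoeff₂ [i, j, l] [] (B (gen α ⊗ₜ[ℂ] (gen p * gen q))) =
      if p = i then a l j α q else 0 := by
  simp [h.apply_gen_mul_gen hB, ite_and, Finset.sum_add_distrib]

theorem HasTensors.wordCoeff₂_mul_zero_three (h : HasTensors B r a) (hB : IsDoubleBracket B)
    (α p q i j l : Fin m) :
    wordCoeff₂ [] [i, j, l] (B (gen α ⊗ₜ[ℂ] (gen p * gen q))) =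
      -(if q = l then a j i p α else 0) := by
  simp [h.apply_gen_mul_gen hB, ite_and, Finset.sum_add_distrib]

theorem HasTensors.wordCoeff₂_mul_two_one (h : HasTensors B r a) (hB : IsDoubleBracket B)
    (α p q i j l : Fin m) :
    wordCoeff₂ [i, j] [l] (B (gen α ⊗ₜ[ℂ] (gen p * gen q))) =
      (if p = i then r j l α q else 0) + if q = l then a j i α p else 0 := by
  simp [h.apply_gen_mul_gen hB, ite_and, Finset.sum_add_distrib]

theorem HasTensors.wordCoeff₂_mul_one_two (h : HasTensors B r a) (hB : IsDoubleBracket B)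
    (α p q i j l : Fin m) :
    wordCoeff₂ [l] [i, j] (B (gen α ⊗ₜ[ℂ] (gen p * gen q))) =
      -(if p = l then a j i q α else 0) + if q = j then r l i α p else 0 := by
  simp [h.apply_gen_mul_gen hB, ite_and, Finset.sum_add_distrib]

/-- The coefficients of `R₁₂R₂₃` on three generators. Only `x_p ⊗ x_q` and `x_p x_q ⊗ 1` in
`⦃x_β, x_τ⦄` contribute, since `⦃x_α, 1⦄ = 0`. -/
theorem HasTensors.wordCoeff₃_opR12_opR23 (h : HasTensors B r a) (hB : IsDoubleBracket B)
    (w₁ w₂ w₃ : List (Fin m)) (α β τ : Fin m) :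
    wordCoeff₃ w₁ w₂ w₃ (opR12 B (opR23 B (gen α ⊗ₜ[ℂ] (gen β ⊗ₜ[ℂ] gen τ)))) =
      ∑ p : Fin m, ∑ q : Fin m,
        (r p q β τ * (wordCoeff₂ w₁ w₂ (B (gen α ⊗ₜ[ℂ] gen p)) * if [q] = w₃ then 1 else 0)
          + a q p β τ * (wordCoeff₂ w₁ w₂ (B (gen α ⊗ₜ[ℂ] (gen p * gen q))) *
              if [] = w₃ then 1 else 0)) := by
  rw [opR23_tmul, h β τ]
  simp only [TensorProduct.tmul_sum, TensorProduct.tmul_add, TensorProduct.tmul_sub,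
    TensorProduct.tmul_smul, map_sum, map_add, map_sub, map_smul, opR12_tmul, wordCoeff₃_assoc,
    hB.apply_one_right, map_zero, zero_mul, mul_zero, sub_zero, wordCoeff_gen, wordCoeff_one,
    smul_eq_mul]

theorem HasTensors.isSkew (h : HasTensors B r a) (hB : IsDoubleBracket B) : IsSkew r := by
  have hcomm (w₁ w₂ : List (Fin m)) (X : Free m ⊗[ℂ] Free m) :
      wordCoeff₂ w₁ w₂ (TensorProduct.comm ℂ _ _ X) = wordCoeff₂ w₂ w₁ X := by
    induction X with
    | zero => simp
    | tmul a b => exact mul_comm _ _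
    | add x y hx hy => rw [map_add, map_add, map_add, hx, hy]
  intro σ ε α β
  rw [← h.wordCoeff₂_one_one σ ε α β, hB.skew, map_neg, hcomm, h.wordCoeff₂_one_one]

end HasTensors

/-- The skew-symmetry of `r` and the equations that the double Jacobi identity imposes on the
tensors of a quadratic bracket. The equations are the coefficients of the Jacobiator of the
generators `α`, `β`, `τ` at three words with the letters `i`, `j`, `l`, where the lengths of the
words are `(1, 1, 1)`, `(3, 0, 0)`, `(2, 1, 0)` and `(2, 0, 1)`. -/
structure TensorEquations {m : ℕ} (r a : Tensor22 m) : Prop where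
  skew : IsSkew r
  eq_one_one_one : ∀ α β τ i j l,
    ∑ σ, r σ l β τ * r i j α σ + ∑ σ, r σ j α β * r l i τ σ + ∑ σ, r σ i τ α * r j l β σ = 0
  eq_three_zero_zero : ∀ α β τ i j l,
    ∑ σ, a σ i β τ * a l j α σ - ∑ σ, a l σ α β * a j i σ τ = 0
  eq_two_one_zero : ∀ α β τ i j l,
    ∑ σ, a σ i β τ * r j l α σ + ∑ σ, a l σ β τ * a j i α σ - ∑ σ, r σ l α β * a j i σ τ = 0
  eq_two_zero_one : ∀ α β τ i j l,
    ∑ σ, r σ l β τ * a j i α σ - ∑ σ, a σ l α β * a j i σ τ + ∑ σ, a j σ α β * r l i τ σ = 0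

theorem HasTensors.tensorEquations {m : ℕ} {B : Bracket m} {r a : Tensor22 m}
    (h : HasTensors B r a) (hB : IsDoublePoisson B) : TensorEquations r a := by
  have hB' := hB.isDoubleBracket
  have key (w₁ w₂ w₃ : List (Fin m)) (α β τ : Fin m) :
      wordCoeff₃ w₁ w₂ w₃ (opR12 B (opR23 B (gen α ⊗ₜ[ℂ] (gen β ⊗ₜ[ℂ] gen τ)))) +
      wordCoeff₃ w₃ w₁ w₂ (opR12 B (opR23 B (gen τ ⊗ₜ[ℂ] (gen α ⊗ₜ[ℂ] gen β)))) +
      wordCoeff₃ w₂ w₃ w₁ (opR12 B (opR23 B (gen β ⊗ₜ[ℂ] (gen τ ⊗ₜ[ℂ] gen α)))) = 0 := by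
    have hJ : jacobiator B (gen α ⊗ₜ[ℂ] (gen β ⊗ₜ[ℂ] gen τ)) = 0 :=
      LinearMap.congr_fun hB.jacobi _
    have := congrArg (wordCoeff₃ w₁ w₂ w₃) hJ
    rwa [jacobiator_apply, map_zero, map_add, map_add, wordCoeff₃_cyc, wordCoeff₃_cyc_symm,
      cyc_tmul, cyc_symm_tmul] at this
  -- the cyclic permutation of the words turns the three terms into coefficients of `R₁₂R₂₃`
  simp only [h.wordCoeff₃_opR12_opR23 hB'] at key
  refine ⟨h.isSkew hB', fun α β τ i j l => ?_, fun α β τ i j l => ?_, fun α β τ i j l => ?_,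
    fun α β τ i j l => ?_⟩
  · have := key [i] [j] [l] α β τ
    simpa [h.wordCoeff₂_one_one] using this
  · have := key [i, j, l] [] [] α β τ
    simp [h.wordCoeff₂_mul_three_zero hB', h.wordCoeff₂_mul_zero_three hB'] at this
    linear_combination this
  · have := key [i, j] [l] [] α β τ
    simp [h.wordCoeff₂_mul_two_one hB', h.wordCoeff₂_zero_two, mul_add,
      Finset.sum_add_distrib] at this
    linear_combination this
  · have := key [i, j] [] [l] α β τ
    simp [h.wordCoeff₂_mul_one_two hB', h.wordCoeff₂_two_zero, mul_add,
      Finset.sum_add_distrib] at this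
    linear_combination this

/-! ### Solutions of the tensor equations in two variables -/

/-- For the tensor `r` of the Cases 1 to 3, every solution `a` is one of three. -/
theorem TensorEquations.eq_caseA_of_caseR_zero {a : Tensor22 2}
    (h : TensorEquations (caseR 0) a) : a = caseA 0 ∨ a = caseA 1 ∨ a = caseA 2 := by
  -- The quadratic parts cancel in suitable linear combinations of the equations. What is left are
  -- ten linear relations between the components of `a`.
  have h0100 : a 0 1 0 0 = 0 := by
    linear_combination (norm := (simp [Fin.sum_univ_two, caseR, unitTensor]; ring))
      1 / 2 * (h.eq_two_zero_one 1 0 0 1 0 0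
      + h.eq_two_one_zero 1 1 0 1 0 1
      + h.eq_two_zero_one 1 0 1 0 1 1
      + h.eq_two_zero_one 0 0 1 0 0 1
      + h.eq_two_one_zero 0 1 0 1 0 0
      + h.eq_two_zero_one 1 0 1 1 0 1
      - h.eq_two_zero_one 0 1 0 1 0 0
      - h.eq_two_zero_one 1 1 0 1 1 0)
  have h1000 : a 1 0 0 0 = 0 := by
    linear_combination (norm := (simp [Fin.sum_univ_two, caseR, unitTensor]; ring))
      1 / 2 * (h.eq_two_one_zero 1 0 0 0 1 0
      + h.eq_two_one_zero 1 0 1 1 1 0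
      - h.eq_two_one_zero 0 1 0 0 0 1
      - h.eq_two_one_zero 0 1 1 1 0 1
      - h.eq_two_zero_one 0 1 0 0 1 0
      - h.eq_two_one_zero 1 0 1 0 1 1
      - h.eq_two_zero_one 0 1 1 0 1 1
      - h.eq_two_one_zero 0 0 1 0 1 0)
  have h1100 : a 1 1 0 0 = 0 := by
    linear_combination (norm := (simp [Fin.sum_univ_two, caseR, unitTensor]; ring))
      - h.eq_two_one_zero 0 0 0 1 0 0
      - h.eq_two_zero_one 0 0 1 1 0 1
      - h.eq_two_one_zero 1 0 0 1 0 1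
      - h.eq_two_zero_one 0 0 0 1 0 0
  have h1101 : a 1 1 0 1 = 0 := by
    linear_combination (norm := (simp [Fin.sum_univ_two, caseR, unitTensor]; ring))
      1 / 2 * (h.eq_two_zero_one 0 1 0 0 1 0
      + h.eq_two_one_zero 1 0 1 0 1 1
      + h.eq_two_zero_one 0 1 1 0 1 1
      + h.eq_two_one_zero 0 0 1 0 1 0
      + h.eq_two_one_zero 1 0 0 0 1 0
      + h.eq_two_one_zero 1 0 1 1 1 0
      - h.eq_two_one_zero 0 1 0 0 0 1
      - h.eq_two_one_zero 0 1 1 1 0 1)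
  have h1110 : a 1 1 1 0 = 0 := by
    linear_combination (norm := (simp [Fin.sum_univ_two, caseR, unitTensor]; ring))
      1 / 2 * (h.eq_two_zero_one 1 0 1 0 1 1
      + h.eq_two_zero_one 0 0 1 0 0 1
      - h.eq_two_zero_one 0 1 0 1 0 0
      - h.eq_two_zero_one 1 1 0 1 1 0
      - h.eq_two_zero_one 1 0 0 1 0 0
      - h.eq_two_one_zero 1 1 0 1 0 1
      - h.eq_two_one_zero 0 1 0 1 0 0
      - h.eq_two_zero_one 1 0 1 1 0 1)
  have h0101_1010 : a 1 0 1 0 = a 0 1 0 1 := by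
    linear_combination (norm := (simp [Fin.sum_univ_two, caseR, unitTensor]; ring))
      1 / 2 * (h.eq_two_one_zero 1 1 0 0 1 0
      + h.eq_two_zero_one 1 1 1 1 1 0
      + h.eq_two_zero_one 0 1 1 1 0 0
      + h.eq_two_one_zero 1 1 1 1 1 0
      - h.eq_two_one_zero 1 1 1 1 0 1
      - h.eq_two_one_zero 1 1 0 0 0 1
      - h.eq_two_zero_one 1 1 1 0 1 1
      - h.eq_two_zero_one 0 1 1 0 0 1)
  have h0000_1111 : a 1 1 1 1 = a 0 0 0 0 := by
    linear_combination (norm := (simp [Fin.sum_univ_two, caseR, unitTensor]; ring))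
      1 / 2 * (h.eq_two_zero_one 1 1 1 0 1 1
      + h.eq_two_zero_one 0 1 1 0 0 1
      + h.eq_two_one_zero 1 1 0 0 1 0
      + h.eq_two_one_zero 1 1 1 1 1 0
      - h.eq_two_zero_one 1 1 1 1 1 0
      - h.eq_two_zero_one 0 1 1 1 0 0
      - h.eq_two_one_zero 1 1 1 1 0 1
      - h.eq_two_one_zero 1 1 0 0 0 1)
  have h0000_0101_0110 : a 0 0 0 0 + a 0 1 1 0 = a 0 1 0 1 := by
    linear_combination (norm := (simp [Fin.sum_univ_two, caseR, unitTensor]; ring))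
      h.eq_three_zero_zero 1 1 0 0 1 0
      + h.eq_three_zero_zero 1 1 1 1 1 0
      - h.eq_two_zero_one 0 0 1 0 0 0
      - h.eq_two_one_zero 1 1 0 1 0 0
      - h.eq_two_zero_one 0 1 1 0 0 1
      - h.eq_two_one_zero 0 0 1 0 0 0
  have h0000_0101_1001 : a 0 0 0 0 + a 1 0 0 1 = a 0 1 0 1 := by
    linear_combination (norm := (simp [Fin.sum_univ_two, caseR, unitTensor]; ring))
      - h.eq_two_zero_one 0 1 1 0 0 1
      - h.eq_two_one_zero 1 0 1 0 0 1
      - h.eq_two_zero_one 0 1 0 0 0 0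
      - h.eq_two_one_zero 0 0 1 0 0 0
  have h0001_0010_0111_1011 : a 0 0 1 0 + a 1 0 1 1 = a 0 0 0 1 + a 0 1 1 1 := by
    linear_combination (norm := (simp [Fin.sum_univ_two, caseR, unitTensor]; ring))
      - h.eq_two_one_zero 0 1 1 0 0 0
      - h.eq_two_zero_one 1 1 0 0 0 0
      - h.eq_two_zero_one 1 1 1 0 0 1
      - h.eq_two_one_zero 1 1 1 0 0 1
  -- two of the equations become squares, and the others are idempotent and orthogonality relations
  have h0101 : a 0 1 0 1 = 0 := by
    have : a 0 1 0 1 ^ 2 = 0 := by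
      linear_combination (norm := (simp [Fin.sum_univ_two, caseR, unitTensor]; ring))
        h.eq_two_one_zero 0 0 1 1 0 0 - a 0 0 0 1 * h0100
    simpa using this
  have h0000 : a 0 0 0 0 = 0 := by
    have : a 0 0 0 0 ^ 2 = 0 := by
      linear_combination (norm := (simp [Fin.sum_univ_two, caseR, unitTensor]; ring))
        h.eq_two_one_zero 0 0 0 0 0 0 - a 0 0 0 1 * h0100
    simpa using this
  have h0110 : a 0 1 1 0 = 0 := by linear_combination h0000_0101_0110 - h0000 + h0101
  have h1001 : a 1 0 0 1 = 0 := by linear_combination h0000_0101_1001 - h0000 + h0101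
  have h1010 : a 1 0 1 0 = 0 := by linear_combination h0101_1010 + h0101
  have h1111 : a 1 1 1 1 = 0 := by linear_combination h0000_1111 + h0000
  have h1 : a 0 0 1 0 * (a 0 0 1 0 - 1) = 0 := by
    linear_combination (norm := (simp [Fin.sum_univ_two, caseR, unitTensor]; ring))
      h.eq_two_one_zero 1 1 0 0 0 0 - a 0 0 1 1 * h0110
  have h2 : a 0 1 1 1 * (a 0 1 1 1 - 1) = 0 := by
    linear_combination (norm := (simp [Fin.sum_univ_two, caseR, unitTensor]; ring))
      h.eq_two_one_zero 1 1 1 1 0 0 - a 0 0 1 1 * h0110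
  have h3 : a 0 0 1 0 * a 0 0 1 0 = a 0 0 1 0 * a 0 1 1 1 := by
    linear_combination (norm := (simp [Fin.sum_univ_two]; ring))
      h.eq_three_zero_zero 1 1 0 0 0 0 + a 0 0 1 1 * h0000 - a 0 0 1 1 * h1010
  have h4 : a 0 0 1 0 * a 0 1 1 1 = a 0 1 1 1 * a 0 1 1 1 := by
    linear_combination (norm := (simp [Fin.sum_univ_two]; ring))
      h.eq_three_zero_zero 1 1 1 1 0 0 + a 0 0 1 1 * h0101 - a 0 0 1 1 * h1111
  have h0111 : a 0 1 1 1 = a 0 0 1 0 := by linear_combination h1 - h2 - h3 - h4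
  have h1011 : a 1 0 1 1 = a 0 0 0 1 := by
    linear_combination h0001_0010_0111_1011 + h0111
  have h5 : a 0 0 0 1 * (a 0 0 0 1 - 1) = 0 := by
    linear_combination (norm := (simp [Fin.sum_univ_two, caseR, unitTensor]; ring))
      - h.eq_two_zero_one 0 1 1 0 0 0 - a 0 0 1 1 * h1001
  have h6 : a 0 0 0 1 * a 0 0 1 0 = 0 := by
    linear_combination (norm := (simp [Fin.sum_univ_two, caseR, unitTensor]; ring))
      h.eq_two_one_zero 1 0 1 0 0 0 - a 0 0 1 1 * h0101
  have h7 : a 0 0 1 1 * (2 * a 0 0 1 0 - 1) = 0 := by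
    linear_combination (norm := (simp [Fin.sum_univ_two, caseR, unitTensor]; ring))
      h.eq_two_one_zero 1 1 1 0 0 0 - a 0 0 1 1 * h0111
  have hx : a 0 0 1 0 = 0 ∨ a 0 0 1 0 = 1 := by
    simpa [sub_eq_zero] using h1
  have hy : a 0 0 0 1 = 0 ∨ a 0 0 0 1 = 1 := by
    simpa [sub_eq_zero] using h5
  have h0011 : a 0 0 1 1 = 0 := by
    rcases hx with hx | hx <;> rw [hx] at h7
    · linear_combination -h7
    · linear_combination h7
  rcases hx with hx | hx
  · rcases hy with hy | hy
    · left
      ext p q α β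
      fin_cases p <;> fin_cases q <;> fin_cases α <;> fin_cases β <;>
        simp [caseA, *]
    · right; right
      ext p q α β
      fin_cases p <;> fin_cases q <;> fin_cases α <;> fin_cases β <;>
        simp [caseA, unitTensor, *]
  · have hy : a 0 0 0 1 = 0 := by linear_combination h6 - a 0 0 0 1 * hx
    right; left
    ext p q α β
    fin_cases p <;> fin_cases q <;> fin_cases α <;> fin_cases β <;>
      simp [caseA, unitTensor, *]

/-- For the tensor `r` of the Cases 4 to 6, every solution `a` is one of three. -/
theorem TensorEquations.eq_caseA_of_caseR_three {a : Tensor22 2}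
    (h : TensorEquations (caseR 3) a) : a = caseA 3 ∨ a = caseA 4 ∨ a = caseA 5 := by
  -- The quadratic parts cancel in suitable linear combinations of the equations. What is left are
  -- twelve linear relations between the components of `a`.
  have h0001 : a 0 0 0 1 = 0 := by
    linear_combination (norm := (simp [Fin.sum_univ_two, caseR, unitTensor]; ring))
      1 / 2 * (h.eq_two_zero_one 1 1 0 1 1 0
      + h.eq_two_zero_one 0 1 0 1 0 0
      + h.eq_two_one_zero 1 0 1 0 1 1
      + h.eq_two_zero_one 0 1 1 0 1 1
      + h.eq_two_one_zero 0 0 1 0 1 0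
      + h.eq_two_zero_one 0 1 0 0 1 0
      - h.eq_two_zero_one 1 0 1 0 1 1
      - h.eq_two_zero_one 0 0 1 0 0 1)
  have h0010 : a 0 0 1 0 = 0 := by
    linear_combination (norm := (simp [Fin.sum_univ_two, caseR, unitTensor]; ring))
      1 / 2 * (h.eq_two_one_zero 0 1 0 0 1 0
      + h.eq_two_one_zero 0 1 1 1 1 0
      + h.eq_two_zero_one 1 0 0 1 0 0
      + h.eq_two_one_zero 1 1 0 1 0 1
      + h.eq_two_zero_one 1 0 1 1 0 1
      + h.eq_two_one_zero 0 1 0 1 0 0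
      - h.eq_two_one_zero 1 0 1 1 0 1
      - h.eq_two_one_zero 1 0 0 0 0 1)
  have h0011 : a 0 0 1 1 = 0 := by
    linear_combination (norm := (simp [Fin.sum_univ_two, caseR, unitTensor]; ring))
      - h.eq_two_zero_one 0 1 1 0 0 1
      - h.eq_two_one_zero 1 0 1 0 0 1
      - h.eq_two_zero_one 0 1 0 0 0 0
      - h.eq_two_one_zero 0 0 1 0 0 0
  have h0110 : a 0 1 1 0 = 0 := by
    linear_combination (norm := (simp [Fin.sum_univ_two, caseR, unitTensor]; ring))
      1 / 2 * (h.eq_three_zero_zero 1 0 0 1 1 0)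
      + 1 / 2 * (h.eq_two_one_zero 0 1 0 1 1 0)
      + 1 / 2 * (h.eq_three_zero_zero 0 1 0 1 0 1)
      + 1 / 2 * (h.eq_two_one_zero 0 0 1 1 0 1)
      + 1 / 2 * (h.eq_two_zero_one 0 1 0 1 1 0)
      - 1 / 2 * (h.eq_two_zero_one 1 0 0 1 0 1)
      - 1 / 2 * (h.eq_two_one_zero 1 0 0 1 0 1)
      - h.eq_three_zero_zero 0 1 0 1 1 0
      - 1 / 2 * (h.eq_two_one_zero 0 0 1 1 1 0)
  have h0111 : a 0 1 1 1 = 0 := by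
    linear_combination (norm := (simp [Fin.sum_univ_two, caseR, unitTensor]; ring))
      1 / 2 * (h.eq_two_one_zero 0 1 0 0 1 0
      + h.eq_two_one_zero 0 1 1 1 1 0
      - h.eq_two_zero_one 1 0 0 1 0 0
      - h.eq_two_one_zero 1 1 0 1 0 1
      - h.eq_two_zero_one 1 0 1 1 0 1
      - h.eq_two_one_zero 0 1 0 1 0 0
      - h.eq_two_one_zero 1 0 1 1 0 1
      - h.eq_two_one_zero 1 0 0 0 0 1)
  have h1001 : a 1 0 0 1 = 0 := by
    linear_combination (norm := (simp [Fin.sum_univ_two, caseR, unitTensor]; ring))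
      1 / 2 * (h.eq_two_zero_one 0 1 0 1 1 0)
      + 1 / 2 * (h.eq_three_zero_zero 0 1 0 1 0 1)
      + 1 / 2 * (h.eq_two_zero_one 1 0 0 0 1 1)
      + 1 / 2 * (h.eq_two_one_zero 0 1 0 1 1 0)
      + h.eq_three_zero_zero 0 0 0 0 0 1
      + 1 / 2 * (h.eq_three_zero_zero 0 0 1 0 1 1)
      - 1 / 2 * (h.eq_two_zero_one 0 0 1 0 1 1)
      - 1 / 2 * (h.eq_two_zero_one 1 0 0 1 1 0)
      - 1 / 2 * (h.eq_two_one_zero 0 0 1 0 1 1)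
  have h1011 : a 1 0 1 1 = 0 := by
    linear_combination (norm := (simp [Fin.sum_univ_two, caseR, unitTensor]; ring))
      1 / 2 * (h.eq_two_zero_one 1 1 0 1 1 0
      + h.eq_two_zero_one 0 1 0 1 0 0
      - h.eq_two_one_zero 1 0 1 0 1 1
      - h.eq_two_zero_one 0 1 1 0 1 1
      - h.eq_two_one_zero 0 0 1 0 1 0
      - h.eq_two_zero_one 0 1 0 0 1 0
      - h.eq_two_zero_one 1 0 1 0 1 1
      - h.eq_two_zero_one 0 0 1 0 0 1)
  have h0000_0101 : a 0 1 0 1 = a 0 0 0 0 := by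
    linear_combination (norm := (simp [Fin.sum_univ_two, caseR, unitTensor]; ring))
      1 / 2 * (h.eq_two_zero_one 0 1 0 1 0 1)
      + 1 / 2 * (h.eq_two_zero_one 0 0 1 0 1 1)
      - 1 / 2 * (h.eq_two_zero_one 0 1 0 1 1 0)
      - 1 / 2 * (h.eq_two_zero_one 0 0 0 1 0 0)
      - 1 / 2 * (h.eq_two_one_zero 0 0 0 1 0 0)
      - 1 / 2 * (h.eq_three_zero_zero 0 1 0 1 0 1)
      - 1 / 2 * (h.eq_three_zero_zero 0 0 1 0 1 1)
      - h.eq_three_zero_zero 0 1 1 1 1 1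
      - 1 / 2 * (h.eq_two_one_zero 0 0 1 0 1 1)
      - h.eq_two_zero_one 0 0 1 1 0 1
  have h0000_1010 : a 1 0 1 0 = a 0 0 0 0 := by
    linear_combination (norm := (simp [Fin.sum_univ_two, caseR, unitTensor]; ring))
      h.eq_three_zero_zero 1 0 0 1 0 1
      + 1 / 2 * (h.eq_two_one_zero 0 1 0 0 1 1)
      + 1 / 2 * (h.eq_two_one_zero 1 0 0 1 0 1)
      - h.eq_two_one_zero 1 0 0 0 1 1
      - 1 / 2 * (h.eq_two_zero_one 1 0 0 1 0 1)
      - 1 / 2 * (h.eq_three_zero_zero 0 1 0 1 0 1)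
      - 1 / 2 * (h.eq_two_one_zero 0 1 0 1 1 0)
      - 1 / 2 * (h.eq_three_zero_zero 1 0 0 1 1 0)
      - 1 / 2 * (h.eq_two_one_zero 0 0 0 0 1 0)
      - 1 / 2 * (h.eq_two_zero_one 0 0 0 0 1 0)
  have h0000_1111 : a 1 1 1 1 = a 0 0 0 0 := by
    linear_combination (norm := (simp [Fin.sum_univ_two, caseR, unitTensor]; ring))
      1 / 2 * (h.eq_two_zero_one 0 1 0 1 0 1
      + h.eq_two_one_zero 0 1 1 1 1 1
      + h.eq_two_one_zero 0 1 0 0 1 1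
      + h.eq_two_zero_one 1 1 0 1 1 1
      - h.eq_two_one_zero 1 0 1 1 1 1
      - h.eq_two_zero_one 0 0 1 1 0 1
      - h.eq_two_one_zero 1 0 0 0 1 1
      - h.eq_two_zero_one 1 0 1 1 1 1)
  have h1000_1101 : a 1 1 0 1 = a 1 0 0 0 := by
    linear_combination (norm := (simp [Fin.sum_univ_two, caseR, unitTensor]; ring))
      1 / 2 * (h.eq_two_one_zero 0 1 0 1 1 1
      + h.eq_two_zero_one 0 1 0 1 1 1
      + h.eq_three_zero_zero 0 0 0 0 1 1
      + h.eq_three_zero_zero 0 0 1 1 1 1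
      + h.eq_two_one_zero 0 0 0 0 1 1
      - h.eq_two_zero_one 0 0 1 1 1 1
      - h.eq_two_one_zero 0 0 1 1 1 1
      - h.eq_two_one_zero 0 0 0 1 1 0)
  have h0100_1110 : a 1 1 1 0 = a 0 1 0 0 := by
    linear_combination (norm := (simp [Fin.sum_univ_two, caseR, unitTensor]; ring))
      1 / 2 * (h.eq_three_zero_zero 1 0 0 1 1 1
      + h.eq_two_zero_one 0 0 0 1 0 1
      + h.eq_three_zero_zero 0 0 0 1 1 0
      - h.eq_two_zero_one 1 0 0 1 1 1
      - h.eq_two_one_zero 1 0 0 1 1 1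
      - h.eq_two_zero_one 0 0 0 1 1 0
      - h.eq_two_zero_one 0 0 0 0 1 1
      - h.eq_two_one_zero 0 0 0 1 0 1)
  -- one of the equations becomes a square, and the others are idempotent and orthogonality relations
  have h0000 : a 0 0 0 0 = 0 := by
    have : a 0 0 0 0 ^ 2 = 0 := by
      linear_combination (norm := (simp [Fin.sum_univ_two, caseR, unitTensor]; ring))
        h.eq_two_one_zero 0 0 0 0 0 0 - a 0 1 0 0 * h0001
    simpa using this
  have h0101 : a 0 1 0 1 = 0 := by linear_combination h0000_0101 + h0000
  have h1010 : a 1 0 1 0 = 0 := by linear_combination h0000_1010 + h0000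
  have h1111 : a 1 1 1 1 = 0 := by linear_combination h0000_1111 + h0000
  have h1 : a 1 0 0 0 * (a 1 0 0 0 - 1) = 0 := by
    linear_combination (norm := (simp [Fin.sum_univ_two, caseR, unitTensor]; ring))
      h.eq_two_one_zero 0 0 0 0 1 1 - a 1 1 0 0 * h1001
  have h2 : a 0 1 0 0 * (a 0 1 0 0 + 1) = 0 := by
    linear_combination (norm := (simp [Fin.sum_univ_two, caseR, unitTensor]; ring))
      - h.eq_two_zero_one 0 0 0 1 0 1 - a 1 1 0 0 * h0110
  have h3 : a 1 0 0 0 * a 0 1 0 0 = 0 := by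
    linear_combination (norm := (simp [Fin.sum_univ_two, caseR, unitTensor]; ring))
      h.eq_two_one_zero 0 0 0 1 1 0 - a 0 1 0 0 * h1000_1101 - a 1 1 0 0 * h0000
  have h4 : a 1 1 0 0 * (2 * a 1 0 0 0 - 1) = 0 := by
    linear_combination (norm := (simp [Fin.sum_univ_two, caseR, unitTensor]; ring))
      h.eq_two_one_zero 0 0 0 1 1 1 - a 1 1 0 0 * h1000_1101
  have hx : a 1 0 0 0 = 0 ∨ a 1 0 0 0 = 1 := by
    simpa [sub_eq_zero] using h1
  have hy : a 0 1 0 0 = 0 ∨ a 0 1 0 0 = -1 := by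
    simpa [add_eq_zero_iff_eq_neg] using h2
  have h1100 : a 1 1 0 0 = 0 := by
    rcases hx with hx | hx <;> rw [hx] at h4
    · linear_combination -h4
    · linear_combination h4
  rcases hx with hx | hx
  · rcases hy with hy | hy
    · left
      ext p q α β
      fin_cases p <;> fin_cases q <;> fin_cases α <;> fin_cases β <;>
        simp [caseA, *]
    · right; right
      ext p q α β
      fin_cases p <;> fin_cases q <;> fin_cases α <;> fin_cases β <;>
        simp [caseA, unitTensor, *]
  · have hy : a 0 1 0 0 = 0 := by linear_combination h3 - a 0 1 0 0 * hx
    right; left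
    ext p q α β
    fin_cases p <;> fin_cases q <;> fin_cases α <;> fin_cases β <;>
      simp [caseA, unitTensor, *]

/-- For `r = 0`, if the first basis vector annihilates the first factor of `a`, then `a` is a
multiple of the tensor of Case 7. -/
theorem TensorEquations.eq_smul_caseA_six {a : Tensor22 2} (h : TensorEquations 0 a)
    (h0 : ∀ p q β, a p q 0 β = 0) : a = a 0 0 1 1 • caseA 6 := by
  have sq {x : ℂ} (hx : x ^ 2 = 0) : x = 0 := by simpa using hx
  have h1010 : a 1 0 1 0 = 0 :=
    sq (by linear_combination (norm := (simp [Fin.sum_univ_two, h0]; ring)) -h.eq_two_zero_one 1 0 0 0 1 0)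
  have h1110 : a 1 1 1 0 = 0 :=
    sq (by linear_combination (norm := (simp [Fin.sum_univ_two, h0]; ring)) -h.eq_two_zero_one 1 0 0 1 1 1)
  have h0110 : a 0 1 1 0 = 0 :=
    sq (by linear_combination (norm := (simp [Fin.sum_univ_two, h0]; ring)) -h.eq_three_zero_zero 1 0 0 1 0 0)
  have h1011 : a 1 0 1 1 = 0 :=
    sq (by linear_combination (norm := (simp [Fin.sum_univ_two, h0]; ring)) -h.eq_two_zero_one 1 1 1 0 1 0)
  have h1111 : a 1 1 1 1 = 0 :=
    sq (by linear_combination (norm := (simp [Fin.sum_univ_two, h0]; ring)) -h.eq_two_zero_one 1 1 1 1 1 1)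
  have h0111 : a 0 1 1 1 = 0 :=
    sq (by linear_combination (norm := (simp [Fin.sum_univ_two]; ring)) h.eq_two_one_zero 1 1 1 1 0 0 - a 0 0 1 1 * h0110)
  have h0010 : a 0 0 1 0 = 0 :=
    sq (by linear_combination (norm := (simp [Fin.sum_univ_two]; ring)) h.eq_two_one_zero 1 1 0 0 0 0 - a 0 0 1 1 * h0110)
  ext p q α β
  fin_cases p <;> fin_cases q <;> fin_cases α <;> fin_cases β <;>
    simp [caseA, unitTensor, *]

/-- The skew solutions `r` of the `(1, 1, 1)` equations, a form of the associative Yang-Baxter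
equation, in two variables: `r` is either symmetric in the lower and skew-symmetric in the upper
indices, or the other way round, and in both cases the components are those of a symmetric matrix
of determinant zero. -/
theorem TensorEquations.r_cases {r a : Tensor22 2} (h : TensorEquations r a) :
    (r 0 0 0 1 = 0 ∧ r 1 1 0 1 = 0 ∧ r 0 1 1 0 = r 0 1 0 1 ∧
      r 0 1 0 1 ^ 2 = r 0 1 0 0 * r 0 1 1 1) ∨
    (r 0 1 0 0 = 0 ∧ r 0 1 1 1 = 0 ∧ r 0 1 1 0 = -r 0 1 0 1 ∧
      r 0 1 0 1 ^ 2 = r 0 0 0 1 * r 1 1 0 1) := by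
  have hd (σ α : Fin 2) : r σ σ α α = 0 := by
    have := h.skew σ σ α α
    linear_combination this / 2
  have h0 : r 0 0 1 0 = -r 0 0 0 1 := h.skew _ _ _ _
  have h1 : r 1 1 1 0 = -r 1 1 0 1 := h.skew _ _ _ _
  have h2 (α β : Fin 2) : r 1 0 α β = -r 0 1 β α := h.skew _ _ _ _
  have e1 : r 0 0 0 1 * r 0 1 0 0 = 0 := by
    have := h.eq_one_one_one 0 0 1 0 1 0
    simp only [Fin.sum_univ_two, hd, h0, h2] at this
    linear_combination this
  have e2 : r 0 1 0 0 * (r 0 1 1 0 - r 0 1 0 1) = 0 := by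
    have := h.eq_one_one_one 0 0 0 0 1 0
    simp only [Fin.sum_univ_two, hd, h2] at this
    linear_combination this
  have e3 : r 0 1 0 0 * r 1 1 0 1 = 0 := by
    have := h.eq_one_one_one 0 0 0 1 1 0
    simp only [Fin.sum_univ_two, hd, h2] at this
    linear_combination -this
  have e4 : r 0 0 0 1 * (r 0 1 0 1 + r 0 1 1 0) = 0 := by
    have := h.eq_one_one_one 0 0 1 0 0 0
    simp only [Fin.sum_univ_two, hd, h0, h2] at this
    linear_combination -this
  have e5 : r 0 1 1 0 ^ 2 = r 0 0 0 1 * r 1 1 0 1 + r 0 1 0 0 * r 0 1 1 1 + r 0 0 0 1 * r 0 1 0 0 := by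
    have := h.eq_one_one_one 0 0 1 1 0 0
    simp only [Fin.sum_univ_two, hd, h1, h2] at this
    linear_combination this
  have e6 : r 0 0 0 1 * r 0 1 1 1 = 0 := by
    have := h.eq_one_one_one 0 1 1 0 0 0
    simp only [Fin.sum_univ_two, hd, h0, h2] at this
    linear_combination -this
  have e7 : r 0 1 1 1 * r 1 1 0 1 = 0 := by
    have := h.eq_one_one_one 0 1 1 1 1 0
    simp only [Fin.sum_univ_two, hd, h1, h2] at this
    linear_combination this
  have e8 : r 0 1 0 1 ^ 2 + r 0 1 1 1 * r 1 1 0 1 = r 0 0 0 1 * r 1 1 0 1 + r 0 1 0 0 * r 0 1 1 1 := by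
    have := h.eq_one_one_one 0 1 1 0 1 1
    simp only [Fin.sum_univ_two, hd, h0, h1, h2] at this
    linear_combination -this
  have e9 : (r 0 1 0 1 + r 0 1 1 0) * r 1 1 0 1 = 0 := by
    have := h.eq_one_one_one 0 1 1 1 1 1
    simp only [Fin.sum_univ_two, hd, h1] at this
    linear_combination -this
  have e10 : (r 0 1 1 0 - r 0 1 0 1) * r 0 1 1 1 = 0 := by
    have := h.eq_one_one_one 1 1 1 1 1 0
    simp only [Fin.sum_univ_two, hd, h1, h2] at this
    linear_combination this
  -- `r 0 1 0 1` and `r 0 1 1 0` are equal up to sign, and the sign decides between the two types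
  by_cases hA : r 0 0 0 1 = 0
  · by_cases hF : r 1 1 0 1 = 0
    · have hC : r 0 1 0 1 ^ 2 = r 0 1 0 0 * r 0 1 1 1 := by
        linear_combination e8 + r 0 0 0 1 * hF - r 0 1 1 1 * hF
      have hCD : (r 0 1 1 0 - r 0 1 0 1) * (r 0 1 1 0 + r 0 1 0 1) = 0 := by
        linear_combination e5 - e8 + e7 + e1
      rcases mul_eq_zero.1 hCD with hCD | hCD
      · exact Or.inl ⟨hA, hF, by linear_combination hCD, hC⟩
      · by_cases hC0 : r 0 1 0 1 = 0
        · exact Or.inl ⟨hA, hF, by linear_combination hCD - 2 * hC0, hC⟩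
        · have h' : r 0 1 1 0 - r 0 1 0 1 ≠ 0 := by
            intro h'
            exact hC0 (by linear_combination hCD / 2 - h' / 2)
          have hB := (mul_eq_zero.1 e2).resolve_right h'
          have hE := (mul_eq_zero.1 e10).resolve_left h'
          refine absurd ?_ (pow_ne_zero 2 hC0)
          rw [hC, hB, zero_mul]
    · have hB := (mul_eq_zero.1 e3).resolve_right hF
      have hE := (mul_eq_zero.1 e7).resolve_right hF
      have hCD := (mul_eq_zero.1 e9).resolve_right hF
      exact Or.inr ⟨hB, hE, by linear_combination hCD, by
        linear_combination e8 - e7 + r 0 1 1 1 * hB⟩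
  · have hB := (mul_eq_zero.1 e1).resolve_left hA
    have hE := (mul_eq_zero.1 e6).resolve_left hA
    have hCD := (mul_eq_zero.1 e4).resolve_left hA
    exact Or.inr ⟨hB, hE, by linear_combination hCD, by
      linear_combination e8 - e7 + r 0 1 1 1 * hB⟩

/-! ### Linear changes of generators -/

section LinearChange

variable {m : ℕ}

theorem linearChange_gen (g : GL (Fin m) ℂ) (i : Fin m) :
    linearChange g (gen i) = ∑ j, (g : Matrix (Fin m) (Fin m) ℂ) i j • gen j :=
  FreeAlgebra.lift_ι_apply _ _

theorem linearChange_comp (g h : GL (Fin m) ℂ) (a : Free m) :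
    linearChange h (linearChange g a) = linearChange (g * h) a := by
  have : (linearChange h).comp (linearChange g) = linearChange (g * h) := by
    ext i
    change linearChange h (linearChange g (gen i)) = linearChange (g * h) (gen i)
    simp only [linearChange_gen, map_sum, map_smul, Finset.smul_sum, smul_smul, Units.val_mul,
      Matrix.mul_apply, Finset.sum_smul]
    exact Finset.sum_comm
  exact DFunLike.congr_fun this a

theorem linearChange_one (a : Free m) : linearChange 1 a = a := by
  have : linearChange (1 : GL (Fin m) ℂ) = AlgHom.id ℂ _ := by
    ext i
    change linearChange 1 (gen i) = gen i
    simp [linearChange_gen, Matrix.one_apply]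
  exact DFunLike.congr_fun this a

theorem map_linearChange_comp (g h : GL (Fin m) ℂ) (t : Free m ⊗[ℂ] Free m) :
    TensorProduct.map (linearChange h).toLinearMap (linearChange h).toLinearMap
      (TensorProduct.map (linearChange g).toLinearMap (linearChange g).toLinearMap t) =
    TensorProduct.map (linearChange (g * h)).toLinearMap (linearChange (g * h)).toLinearMap t := by
  induction t with
  | zero => simp
  | tmul a b => simp [linearChange_comp]
  | add x y hx hy => simp only [map_add, hx, hy]

theorem map_linearChange_one (t : Free m ⊗[ℂ] Free m) :
    TensorProduct.map (linearChange (1 : GL (Fin m) ℂ)).toLinearMap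
      (linearChange (1 : GL (Fin m) ℂ)).toLinearMap t = t := by
  induction t with
  | zero => simp
  | tmul a b => simp [linearChange_one]
  | add x y hx hy => simp only [map_add, hx, hy]

theorem LinEquivalent.symm {B₁ B₂ : Bracket m} (h : LinEquivalent B₁ B₂) :
    LinEquivalent B₂ B₁ := by
  obtain ⟨g, hg⟩ := h
  refine ⟨g⁻¹, fun a b => ?_⟩
  have := hg (linearChange g⁻¹ a) (linearChange g⁻¹ b)
  rw [linearChange_comp, linearChange_comp, inv_mul_cancel, linearChange_one,
    linearChange_one] at this
  rw [this, map_linearChange_comp, mul_inv_cancel, map_linearChange_one]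

theorem LinEquivalent.trans {B₁ B₂ B₃ : Bracket m} (h : LinEquivalent B₁ B₂)
    (h' : LinEquivalent B₂ B₃) : LinEquivalent B₁ B₃ := by
  obtain ⟨g, hg⟩ := h
  obtain ⟨g', hg'⟩ := h'
  refine ⟨g * g', fun a b => ?_⟩
  rw [← linearChange_comp, ← linearChange_comp, hg', hg, map_linearChange_comp]

theorem LinEquivalent.ne_zero {B₁ B₂ : Bracket m} (h : LinEquivalent B₁ B₂) (h₁ : B₁ ≠ 0) :
    B₂ ≠ 0 := by
  rintro rfl
  obtain ⟨g, hg⟩ := h.symm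
  apply h₁
  refine TensorProduct.ext' fun a b => ?_
  have := hg (linearChange g⁻¹ a) (linearChange g⁻¹ b)
  rwa [linearChange_comp, linearChange_comp, inv_mul_cancel, linearChange_one,
    linearChange_one, LinearMap.zero_apply, map_zero] at this

/-- The two tensors `t` and `t'` are related by the change of basis with matrix `h`: if `t` holds
the components with respect to a basis `x`, then `t'` holds those with respect to the basis
`∑ α, h i α • x α`. The form chosen needs no inverse matrix. -/
def TensorRel (h : Matrix (Fin m) (Fin m) ℂ) (t t' : Tensor22 m) : Prop :=
  ∀ i j s u, ∑ α, ∑ β, h i α * h j β * t s u α β = ∑ p, ∑ q, t' p q i j * h p s * h q u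

theorem wordCoeff₂_map_linearChange_one_one {B : Bracket m} {r a : Tensor22 m}
    (h : HasTensors B r a) (g : GL (Fin m) ℂ) (i j s u : Fin m) :
    wordCoeff₂ [s] [u] (TensorProduct.map (linearChange g).toLinearMap
      (linearChange g).toLinearMap (B (gen i ⊗ₜ[ℂ] gen j))) =
      ∑ p, ∑ q, r p q i j * g p s * g q u := by
  rw [h i j]
  simp [linearChange_gen, mul_assoc]

theorem wordCoeff₂_map_linearChange_two_zero {B : Bracket m} {r a : Tensor22 m}
    (h : HasTensors B r a) (g : GL (Fin m) ℂ) (i j s u : Fin m) :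
    wordCoeff₂ [u, s] [] (TensorProduct.map (linearChange g).toLinearMap
      (linearChange g).toLinearMap (B (gen i ⊗ₜ[ℂ] gen j))) =
      ∑ p, ∑ q, a p q i j * g p s * g q u := by
  rw [h i j]
  simp [linearChange_gen, mul_assoc, Finset.sum_mul, Finset.mul_sum, ite_and]
  exact Finset.sum_comm

/-- Equivalent quadratic brackets have related tensors. -/
theorem HasTensors.tensorRel {B B' : Bracket m} {r a r' a' : Tensor22 m}
    (h : HasTensors B r a) (h' : HasTensors B' r' a') {g : GL (Fin m) ℂ}
    (hg : ∀ a b : Free m, B' (linearChange g a ⊗ₜ[ℂ] linearChange g b) =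
      TensorProduct.map (linearChange g).toLinearMap (linearChange g).toLinearMap
        (B (a ⊗ₜ[ℂ] b))) :
    TensorRel g r' r ∧ TensorRel g a' a := by
  have hL (i j : Fin m) : B' (linearChange g (gen i) ⊗ₜ[ℂ] linearChange g (gen j)) =
      ∑ α, ∑ β, (g i α * g j β) • B' (gen α ⊗ₜ[ℂ] gen β) := by
    simp only [linearChange_gen, TensorProduct.sum_tmul, TensorProduct.tmul_sum,
      TensorProduct.smul_tmul_smul, map_sum, map_smul]
    exact Finset.sum_comm
  constructor <;> intro i j s u
  · rw [← wordCoeff₂_map_linearChange_one_one h, ← hg, hL]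
    simp [h'.wordCoeff₂_one_one]
  · rw [← wordCoeff₂_map_linearChange_two_zero h, ← hg, hL]
    simp [h'.wordCoeff₂_two_zero]

theorem sum_sum_comm {M : Type*} [AddCommMonoid M] (G : Fin m → Fin m → Fin m → Fin m → M) :
    ∑ a, ∑ b, ∑ p, ∑ q, G a b p q = ∑ p, ∑ q, ∑ a, ∑ b, G a b p q := by
  simp only [← Fintype.sum_prod_type' (f := fun a b => ∑ p, ∑ q, G a b p q),
    Finset.sum_comm (s := (Finset.univ : Finset (Fin m × Fin m))),
    Fintype.sum_prod_type]

/-- A sum `∑ t s u α β • T s u`, where `T` is expressed through `E` by the matrix `g`, after the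
change of the lower indices by `h`. -/
theorem sum_smul_sum_transport {M : Type*} [AddCommGroup M] [Module ℂ M]
    (g h : Matrix (Fin m) (Fin m) ℂ) (E T : Fin m → Fin m → M)
    (hT : ∀ s u, T s u = ∑ p, ∑ q, (g s p * g u q) • E p q) (t : Tensor22 m) (i j : Fin m) :
    ∑ α, ∑ β, (h i α * h j β) • ∑ s, ∑ u, t s u α β • T s u =
      ∑ p, ∑ q, (∑ α, ∑ β, ∑ s, ∑ u, h i α * h j β * t s u α β * (g s p * g u q)) • E p q := by
  simp only [hT, Finset.smul_sum, smul_smul, Finset.sum_smul]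
  trans ∑ α, ∑ β, ∑ p, ∑ q, ∑ s, ∑ u, (h i α * h j β * (t s u α β * (g s p * g u q))) • E p q
  · exact Finset.sum_congr rfl fun α _ => Finset.sum_congr rfl fun β _ => sum_sum_comm _
  · simp only [mul_assoc]
    exact sum_sum_comm _


/-- The change of generators carries a quadratic bracket to a quadratic bracket, whose tensors are
found from their relation to the given ones. -/
theorem exists_transport {B : Bracket m} {r a : Tensor22 m} (hB : IsDoublePoisson B)
    (h : HasTensors B r a) (x : GL (Fin m) ℂ) :
    ∃ (B' : Bracket m) (r' a' : Tensor22 m), IsDoublePoisson B' ∧ HasTensors B' r' a' ∧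
      LinEquivalent B B' ∧ TensorRel x r r' ∧ TensorRel x a a' := by
  let φ : Free m →ₗ[ℂ] Free m := (linearChange x⁻¹).toLinearMap
  let ψ : Free m →ₗ[ℂ] Free m := (linearChange x).toLinearMap
  let B' : Bracket m := TensorProduct.map φ φ ∘ₗ B ∘ₗ TensorProduct.map ψ ψ
  have hB'1 (a b : Free m) : B' (linearChange x⁻¹ a ⊗ₜ[ℂ] linearChange x⁻¹ b) =
      TensorProduct.map φ φ (B (a ⊗ₜ[ℂ] b)) := by
    simp only [B', LinearMap.comp_apply, TensorProduct.map_tmul, ψ, AlgHom.toLinearMap_apply]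
    rw [linearChange_comp, linearChange_comp, inv_mul_cancel, linearChange_one, linearChange_one]
  have hB'2 (a b : Free m) : B (linearChange x a ⊗ₜ[ℂ] linearChange x b) =
      TensorProduct.map ψ ψ (B' (a ⊗ₜ[ℂ] b)) := by
    simp only [B', LinearMap.comp_apply, TensorProduct.map_tmul, ψ, φ, AlgHom.toLinearMap_apply]
    rw [map_linearChange_comp, inv_mul_cancel, map_linearChange_one]
  have hDP : IsDoublePoisson B' :=
    hB.conj (linearChange x⁻¹) (linearChange x) (fun a => by
      rw [linearChange_comp, mul_inv_cancel, linearChange_one]) hB'1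
  let T (t : Tensor22 m) : Tensor22 m := fun p q i j =>
    ∑ α, ∑ β, ∑ s, ∑ u, (x i α * x j β * t s u α β * (x⁻¹ s p * x⁻¹ u q) : ℂ)
  have hT : HasTensors B' (T r) (T a) := by
    intro i j
    have hφ (s : Fin m) : φ (gen s) =
        ∑ p, (x⁻¹ : GL (Fin m) ℂ) s p • gen p := linearChange_gen _ _
    have hφ2 (s u : Fin m) : φ (gen s * gen u) =
        ∑ p, ∑ q, ((x⁻¹ : GL (Fin m) ℂ) s p * (x⁻¹ : GL (Fin m) ℂ) u q) • (gen p * gen q) := by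
      rw [show φ (gen s * gen u) = φ (gen s) * φ (gen u) from map_mul (linearChange x⁻¹) _ _,
        hφ, hφ]
      simp only [Finset.sum_mul, Finset.mul_sum, smul_mul_smul_comm]
      exact Finset.sum_comm
    have hφ1 : φ 1 = 1 := map_one (linearChange x⁻¹)
    -- the three kinds of terms of a quadratic bracket are transformed separately
    have e1 := sum_smul_sum_transport (x⁻¹ : GL (Fin m) ℂ).1 x.1
      (fun p q => gen p ⊗ₜ[ℂ] gen q) (fun p q => φ (gen p) ⊗ₜ[ℂ] φ (gen q)) (fun s u => by
        simp only [hφ, TensorProduct.sum_tmul, TensorProduct.tmul_sum,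
          TensorProduct.smul_tmul_smul]
        exact Finset.sum_comm) r i j
    have e2 := sum_smul_sum_transport (x⁻¹ : GL (Fin m) ℂ).1 x.1
      (fun q p => (gen p * gen q) ⊗ₜ[ℂ] (1 : Free m))
      (fun q p => φ (gen p * gen q) ⊗ₜ[ℂ] φ 1) (fun s u => by
        simp only [hφ2, hφ1, TensorProduct.sum_tmul, ← TensorProduct.smul_tmul']
        rw [Finset.sum_comm]
        simp only [mul_comm]) a i j
    have e3 := sum_smul_sum_transport (x⁻¹ : GL (Fin m) ℂ).1 x.1
      (fun p q => (1 : Free m) ⊗ₜ[ℂ] (gen q * gen p))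
      (fun p q => φ 1 ⊗ₜ[ℂ] φ (gen q * gen p)) (fun s u => by
        simp only [hφ2, hφ1, TensorProduct.tmul_sum, TensorProduct.tmul_smul]
        rw [Finset.sum_comm]
        simp only [mul_comm]) a j i
    have hL : B' (gen i ⊗ₜ[ℂ] gen j) =
        ∑ α, ∑ β, (x i α * x j β) •
          TensorProduct.map φ φ (B (gen α ⊗ₜ[ℂ] gen β)) := by
      simp only [B', LinearMap.comp_apply, TensorProduct.map_tmul, ψ,
        AlgHom.toLinearMap_apply, linearChange_gen, TensorProduct.sum_tmul,
        TensorProduct.tmul_sum, TensorProduct.smul_tmul_smul, map_sum, map_smul]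
      exact Finset.sum_comm
    have hR : ∑ α, ∑ β, (x i α * x j β) •
          TensorProduct.map φ φ (B (gen α ⊗ₜ[ℂ] gen β)) =
        (∑ α, ∑ β, (x i α * x j β) • ∑ s, ∑ u, r s u α β • (φ (gen s) ⊗ₜ[ℂ] φ (gen u)))
        + (∑ α, ∑ β, (x i α * x j β) • ∑ s, ∑ u, a s u α β • (φ (gen u * gen s) ⊗ₜ[ℂ] φ 1))
        - ∑ α, ∑ β, (x j α * x i β) •
            ∑ s, ∑ u, a s u α β • (φ 1 ⊗ₜ[ℂ] φ (gen u * gen s)) := by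
      rw [Finset.sum_comm (f := fun α β => (x j α * x i β) •
            ∑ s, ∑ u, a s u α β • (φ 1 ⊗ₜ[ℂ] φ (gen u * gen s)))]
      rw [← Finset.sum_add_distrib, ← Finset.sum_sub_distrib]
      refine Finset.sum_congr rfl fun α _ => ?_
      rw [← Finset.sum_add_distrib, ← Finset.sum_sub_distrib]
      refine Finset.sum_congr rfl fun β _ => ?_
      rw [mul_comm (x j β) (x i α), ← smul_add, ← smul_sub, h α β]
      congr 1
      rw [Finset.sum_comm (f := fun s u => a s u α β • (φ (gen u * gen s) ⊗ₜ[ℂ] φ 1))]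
      simp only [map_sum, map_add, map_sub, map_smul, TensorProduct.map_tmul,
        Finset.sum_add_distrib, Finset.sum_sub_distrib]
    rw [hL, hR]
    refine (congrArg₂ (· - ·) (congrArg₂ (· + ·) e1 e2) e3).trans ?_
    rw [Finset.sum_comm (f := fun p q => (∑ α, ∑ β, ∑ s, ∑ u, x.1 i α * x.1 j β * a s u α β *
      ((x⁻¹ : GL (Fin m) ℂ).1 s p * (x⁻¹ : GL (Fin m) ℂ).1 u q)) •
      (gen q * gen p) ⊗ₜ[ℂ] (1 : Free m))]
    simp only [Finset.sum_add_distrib, Finset.sum_sub_distrib, T]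
  have hrel := hT.tensorRel h hB'2
  exact ⟨B', T r, T a, hDP, hT, ⟨x⁻¹, hB'1⟩, hrel.1, hrel.2⟩

/-- If `hᵀ * c * h = 0` for an invertible matrix `h`, then `c = 0`. -/
theorem eq_zero_of_sum_mul_mul {h : GL (Fin m) ℂ} {c : Fin m → Fin m → ℂ}
    (hc : ∀ s u, ∑ p, ∑ q, c p q * h p s * h q u = 0) : c = 0 := by
  let M : Matrix (Fin m) (Fin m) ℂ := Matrix.of c
  let H : Matrix (Fin m) (Fin m) ℂ := h
  have hM : H.transpose * (M * H) = 0 := by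
    ext s u
    rw [Matrix.zero_apply, ← hc s u]
    simp only [Matrix.mul_apply, Matrix.transpose_apply, Finset.mul_sum]
    refine Finset.sum_congr rfl fun p _ => Finset.sum_congr rfl fun q _ => ?_
    change h p s * (c p q * h q u) = _
    ring
  have hH : IsUnit H := h.isUnit
  have hHt : IsUnit H.transpose := by
    rw [Matrix.isUnit_transpose]; exact hH
  rw [hHt.mul_right_eq_zero, hH.mul_left_eq_zero] at hM
  exact hM

theorem TensorRel.unique {h : GL (Fin m) ℂ} {t t' t'' : Tensor22 m}
    (h' : TensorRel h t t') (h'' : TensorRel h t t'') : t' = t'' := by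
  ext p q i j
  have := eq_zero_of_sum_mul_mul (h := h) (c := fun p q => t' p q i j - t'' p q i j)
    (fun s u => by
      simp only [sub_mul, Finset.sum_sub_distrib]
      rw [← h' i j s u, ← h'' i j s u, sub_self])
  exact sub_eq_zero.1 (congrFun (congrFun this p) q)

/-! ### Invariants of the equivalence -/

theorem TensorRel.eq_zero {h : GL (Fin m) ℂ} {t' : Tensor22 m} (h' : TensorRel h 0 t') :
    t' = 0 :=
  h'.unique fun i j s u => by simp

/-- Symmetry in the upper indices does not depend on the basis. -/
theorem TensorRel.symm_upper {h : GL (Fin m) ℂ} {t t' : Tensor22 m} (h' : TensorRel h t t')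
    (ht : ∀ p q i j, t p q i j = t q p i j) (p q i j : Fin m) : t' p q i j = t' q p i j := by
  have : TensorRel h t (fun p q i j => t' q p i j) := by
    intro i j s u
    simp only [ht s u]
    rw [h' i j u s, Finset.sum_comm]
    exact Finset.sum_congr rfl fun p _ => Finset.sum_congr rfl fun q _ => by ring
  exact congrFun (congrFun (congrFun (congrFun (h'.unique this) p) q) i) j

/-- The contraction of the first upper with the first lower index. -/
def contractFst (t : Tensor22 m) (q j : Fin m) : ℂ := ∑ σ, t σ q σ j

/-- The contraction of the second upper with the second lower index. -/
def contractSnd (t : Tensor22 m) (p i : Fin m) : ℂ := ∑ σ, t p σ i σ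

/-- Up to the change of basis in the two remaining indices, the contraction does not depend on the
basis. -/
theorem TensorRel.contractFst {h : GL (Fin m) ℂ} {t t' : Tensor22 m} (h' : TensorRel h t t')
    (j u : Fin m) :
    ∑ β, h j β * contractFst t u β = ∑ q, contractFst t' q j * h q u := by
  have hinv (α s : Fin m) : ∑ i, h⁻¹ s i * h i α = if s = α then (1 : ℂ) else 0 := by
    have : ((h⁻¹ * h : GL (Fin m) ℂ) : Matrix (Fin m) (Fin m) ℂ) s α =
        (1 : Matrix (Fin m) (Fin m) ℂ) s α := by rw [inv_mul_cancel]; rfl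
    rw [Units.val_mul, Matrix.mul_apply, Matrix.one_apply] at this
    exact this
  have hinv' (i p : Fin m) : ∑ s, h p s * h⁻¹ s i = if p = i then (1 : ℂ) else 0 := by
    have : ((h * h⁻¹ : GL (Fin m) ℂ) : Matrix (Fin m) (Fin m) ℂ) p i =
        (1 : Matrix (Fin m) (Fin m) ℂ) p i := by rw [mul_inv_cancel]; rfl
    rw [Units.val_mul, Matrix.mul_apply, Matrix.one_apply] at this
    exact this
  -- the relation for `i` and `s` is multiplied by `h⁻¹ s i` and summed over `i` and `s`
  have key : ∑ s, ∑ i, h⁻¹ s i * ∑ α, ∑ β, h i α * h j β * t s u α β =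
      ∑ s, ∑ i, h⁻¹ s i * ∑ p, ∑ q, t' p q i j * h p s * h q u := by
    simp only [h' _ j _ u]
  have hL : ∑ s, ∑ i, h⁻¹ s i * ∑ α, ∑ β, h i α * h j β * t s u α β =
      ∑ s, ∑ α, (∑ i, h⁻¹ s i * h i α) * ∑ β, h j β * t s u α β := by
    refine Finset.sum_congr rfl fun s _ => ?_
    simp only [Finset.mul_sum, Finset.sum_mul]
    rw [Finset.sum_comm]
    refine Finset.sum_congr rfl fun α _ => ?_
    rw [Finset.sum_comm]
    exact Finset.sum_congr rfl fun β _ => Finset.sum_congr rfl fun i _ => by ring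
  have hR : ∑ s, ∑ i, h⁻¹ s i * ∑ p, ∑ q, t' p q i j * h p s * h q u =
      ∑ i, ∑ p, (∑ s, h p s * h⁻¹ s i) * ∑ q, t' p q i j * h q u := by
    rw [Finset.sum_comm]
    refine Finset.sum_congr rfl fun i _ => ?_
    simp only [Finset.mul_sum, Finset.sum_mul]
    rw [Finset.sum_comm]
    refine Finset.sum_congr rfl fun p _ => ?_
    rw [Finset.sum_comm]
    exact Finset.sum_congr rfl fun β _ => Finset.sum_congr rfl fun i _ => by ring
  rw [hL, hR] at key
  simp only [hinv, hinv', ite_mul, one_mul, zero_mul, Finset.sum_ite_eq, Finset.sum_ite_eq',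
    Finset.mem_univ, if_true] at key
  simp only [DoublePoisson.contractFst, Finset.mul_sum, Finset.sum_mul]
  rw [Finset.sum_comm, key, Finset.sum_comm]

theorem TensorRel.contractFst_eq_zero {h : GL (Fin m) ℂ} {t t' : Tensor22 m}
    (h' : TensorRel h t t') (ht : DoublePoisson.contractFst t = 0) :
    DoublePoisson.contractFst t' = 0 := by
  have hH : IsUnit (h : Matrix (Fin m) (Fin m) ℂ).transpose := by
    rw [Matrix.isUnit_transpose]; exact h.isUnit
  have : (h : Matrix (Fin m) (Fin m) ℂ).transpose *
      Matrix.of (DoublePoisson.contractFst t') = 0 := by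
    ext u j
    have := h'.contractFst j u
    simp only [ht, Pi.zero_apply, mul_zero, Finset.sum_const_zero] at this
    rw [Matrix.zero_apply, this, Matrix.mul_apply]
    exact Finset.sum_congr rfl fun q _ => mul_comm _ _
  rw [hH.mul_right_eq_zero] at this
  exact this

theorem TensorRel.contractSnd_eq_zero {h : GL (Fin m) ℂ} {t t' : Tensor22 m}
    (h' : TensorRel h t t') (ht : contractSnd t = 0) : contractSnd t' = 0 := by
  -- the exchange of the two tensor factors reduces this to `contractFst`
  have : TensorRel h (fun p q i j => t q p j i) (fun p q i j => t' q p j i) := by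
    intro i j s u
    rw [Finset.sum_comm, Finset.sum_comm (f := fun p q => t' q p j i * h p s * h q u)]
    simpa only [mul_right_comm, mul_comm (h i _)] using h' j i u s
  exact this.contractFst_eq_zero ht

end LinearChange

/-! ### The seven brackets -/

/-- The tensors of the seven cases give the listed values on the generators. -/
theorem sum_case_eq_caseValue (i : Fin 7) (α β : Fin 2) :
    ∑ p : Fin 2, ∑ q : Fin 2,
      (caseR i p q α β • (gen p ⊗ₜ[ℂ] gen q)
        + caseA i q p α β • ((gen p * gen q) ⊗ₜ[ℂ] (1 : Free 2))
        - caseA i p q β α • ((1 : Free 2) ⊗ₜ[ℂ] (gen q * gen p))) = caseValue i α β := by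
  fin_cases i <;> fin_cases α <;> fin_cases β <;>
    simp [Fin.sum_univ_two, caseR, caseA, caseValue, unitTensor, u, v] <;> module

theorem caseValue_skew (i : Fin 7) (α β : Fin 2) :
    caseValue i α β = -TensorProduct.comm ℂ _ _ (caseValue i β α) := by
  fin_cases i <;> fin_cases α <;> fin_cases β <;> simp [caseValue] <;> abel

/-- In two variables the Jacobi identity has to be checked on four triples of generators only, one
in each orbit of the cyclic permutation. -/
theorem IsDoubleBracket.jacobiator_eq_zero_of_four {B : Bracket 2} (hB : IsDoubleBracket B)
    (h : ∀ i j : Fin 2, i ≤ j →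
      jacobiator B (gen i ⊗ₜ[ℂ] (gen i ⊗ₜ[ℂ] gen j)) = 0 ∧
      jacobiator B (gen i ⊗ₜ[ℂ] (gen j ⊗ₜ[ℂ] gen j)) = 0) : jacobiator B = 0 := by
  have rot (a b c : Free 2) (habc : jacobiator B (a ⊗ₜ[ℂ] (b ⊗ₜ[ℂ] c)) = 0) :
      jacobiator B (c ⊗ₜ[ℂ] (a ⊗ₜ[ℂ] b)) = 0 := by
    rw [← cyc_tmul, jacobiator_cyc, habc, map_zero]
  refine hB.jacobiator_eq_zero fun i j l => ?_
  fin_cases i <;> fin_cases j <;> fin_cases l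
  · exact (h 0 0 le_rfl).1
  · exact (h 0 1 zero_le_one).1
  · exact rot _ _ _ (rot _ _ _ (h 0 1 zero_le_one).1)
  · exact (h 0 1 zero_le_one).2
  · exact rot _ _ _ (h 0 1 zero_le_one).1
  · exact rot _ _ _ (h 0 1 zero_le_one).2
  · exact rot _ _ _ (rot _ _ _ (h 0 1 zero_le_one).2)
  · exact (h 1 1 le_rfl).1

set_option maxHeartbeats 1000000 in
-- the Jacobiator is expanded on four triples of generators in each of the seven cases
theorem IsDoubleBracket.jacobiator_case {B : Bracket 2} (hB : IsDoubleBracket B) (i : Fin 7)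
    (hgen : ∀ α β, B (gen α ⊗ₜ[ℂ] gen β) = caseValue i α β) : jacobiator B = 0 := by
  have h00 := hgen 0 0
  have h01 := hgen 0 1
  have h10 := hgen 1 0
  have h11 := hgen 1 1
  clear hgen
  have h2 (a b c : Free 2) := hB.mul_right a b c
  have h1 := hB.apply_one_right
  apply hB.jacobiator_eq_zero_of_four
  clear hB
  intro α β hαβ
  rw [jacobiator_apply, jacobiator_apply]
  fin_cases i <;> simp [caseValue] at h00 h01 h10 h11 <;>
  fin_cases α <;> fin_cases β <;> try (exact absurd hαβ (by decide))
  all_goals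
    simp [cyc_tmul, cyc_symm_tmul, opR23_tmul, opR12_tmul, h00, h01, h10, h11,
        TensorProduct.tmul_add, TensorProduct.tmul_sub, TensorProduct.tmul_neg,
        TensorProduct.add_tmul, TensorProduct.sub_tmul, TensorProduct.neg_tmul, h2,
        h1, mul_add, mul_sub, add_mul, sub_mul, mul_assoc]
  all_goals abel

theorem exists_case (i : Fin 7) :
    ∃ B : Bracket 2, IsDoublePoisson B ∧ HasTensors B (caseR i) (caseA i) := by
  obtain ⟨B, hB, hgen⟩ := exists_isDoubleBracket (caseValue i) (caseValue_skew i)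
  exact ⟨B, ⟨hB.skew, hB.mul_left, hB.mul_right, hB.jacobiator_case i hgen⟩,
    fun α β => (hgen α β).trans (sum_case_eq_caseValue i α β).symm⟩

/-! ### The seven brackets are pairwise inequivalent -/

theorem caseR_eq_zero_iff (i : Fin 7) : caseR i = 0 ↔ i = 6 := by
  fin_cases i <;> simp [caseR, unitTensor, funext_iff, Fin.forall_fin_two]

theorem caseR_symm_upper_iff (i : Fin 7) :
    (∀ p q α β, caseR i p q α β = caseR i q p α β) ↔ 3 ≤ i := by
  fin_cases i <;> simp [caseR, unitTensor, Fin.forall_fin_two] <;> norm_num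

theorem contractFst_caseA_eq_zero_iff (i : Fin 7) :
    contractFst (caseA i) = 0 ↔ i ≠ 2 ∧ i ≠ 5 := by
  simp only [funext_iff, contractFst, Fin.forall_fin_two, Fin.sum_univ_two]
  fin_cases i <;> simp [caseA, unitTensor]

theorem contractSnd_caseA_eq_zero_iff (i : Fin 7) :
    contractSnd (caseA i) = 0 ↔ i ≠ 1 ∧ i ≠ 4 := by
  simp only [funext_iff, contractSnd, Fin.forall_fin_two, Fin.sum_univ_two]
  fin_cases i <;> simp [caseA, unitTensor]

/-- The invariants that separate the cases: the vanishing of `r`, the symmetry of `r` in its upper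
indices and the vanishing of the two contractions of `a`. -/
theorem case_injective {i j : Fin 7} {B B' : Bracket 2} (h : HasTensors B (caseR i) (caseA i))
    (h' : HasTensors B' (caseR j) (caseA j)) (hBB' : LinEquivalent B B') : i = j := by
  obtain ⟨g', hg'⟩ := hBB'.symm
  obtain ⟨g, hg⟩ := hBB'
  obtain ⟨hr, ha⟩ := h.tensorRel h' hg
  obtain ⟨hr', ha'⟩ := h'.tensorRel h hg'
  have h1 : i = 6 ↔ j = 6 := by
    rw [← caseR_eq_zero_iff, ← caseR_eq_zero_iff]
    exact ⟨fun h0 => (h0 ▸ hr').eq_zero, fun h0 => (h0 ▸ hr).eq_zero⟩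
  have h2 : 3 ≤ i ↔ 3 ≤ j := by
    rw [← caseR_symm_upper_iff, ← caseR_symm_upper_iff]
    exact ⟨hr'.symm_upper, hr.symm_upper⟩
  have h3 : i ≠ 2 ∧ i ≠ 5 ↔ j ≠ 2 ∧ j ≠ 5 := by
    rw [← contractFst_caseA_eq_zero_iff, ← contractFst_caseA_eq_zero_iff]
    exact ⟨ha'.contractFst_eq_zero, ha.contractFst_eq_zero⟩
  have h4 : i ≠ 1 ∧ i ≠ 4 ↔ j ≠ 1 ∧ j ≠ 4 := by
    rw [← contractSnd_caseA_eq_zero_iff, ← contractSnd_caseA_eq_zero_iff]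
    exact ⟨ha'.contractSnd_eq_zero, ha.contractSnd_eq_zero⟩
  clear * - h1 h2 h3 h4
  revert h1 h2 h3 h4
  revert i j
  decide

/-! ### Reduction to the normal forms -/

theorem HasTensors.eq_zero {B : Bracket 2} (hB : IsDoublePoisson B) (h : HasTensors B 0 0) :
    B = 0 := by
  have h0 : IsDoubleBracket (0 : Bracket 2) := ⟨by simp, by simp, by simp⟩
  exact hB.isDoubleBracket.ext_generators h0 fun i j => (h i j).trans (by simp)

/-- The bracket `B` is equivalent to the bracket of one of the cases. -/
def EquivCase (B : Bracket 2) : Prop :=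
  ∃ (i : Fin 7) (B' : Bracket 2),
    (IsDoublePoisson B' ∧ HasTensors B' (caseR i) (caseA i)) ∧ LinEquivalent B B'

/-- Once `r` is that of Case 1, the equations on `a` leave only Cases 1 to 3. -/
theorem EquivCase.of_tensorRel_caseR_zero {B : Bracket 2} {r a : Tensor22 2}
    (hB : IsDoublePoisson B) (h : HasTensors B r a) (x : GL (Fin 2) ℂ)
    (hx : TensorRel x r (caseR 0)) : EquivCase B := by
  obtain ⟨B', r', a', hB', h', hBB', hr, -⟩ := exists_transport hB h x
  obtain rfl := hr.unique hx
  rcases (h'.tensorEquations hB').eq_caseA_of_caseR_zero with rfl | rfl | rfl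
  · exact ⟨0, B', ⟨hB', h'⟩, hBB'⟩
  · exact ⟨1, B', ⟨hB', h'⟩, hBB'⟩
  · exact ⟨2, B', ⟨hB', h'⟩, hBB'⟩

/-- Once `r` is that of Case 4, the equations on `a` leave only Cases 4 to 6. -/
theorem EquivCase.of_tensorRel_caseR_three {B : Bracket 2} {r a : Tensor22 2}
    (hB : IsDoublePoisson B) (h : HasTensors B r a) (x : GL (Fin 2) ℂ)
    (hx : TensorRel x r (caseR 3)) : EquivCase B := by
  obtain ⟨B', r', a', hB', h', hBB', hr, -⟩ := exists_transport hB h x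
  obtain rfl := hr.unique hx
  rcases (h'.tensorEquations hB').eq_caseA_of_caseR_three with rfl | rfl | rfl
  · exact ⟨3, B', ⟨hB', h'⟩, hBB'⟩
  · exact ⟨4, B', ⟨hB', h'⟩, hBB'⟩
  · exact ⟨5, B', ⟨hB', h'⟩, hBB'⟩

/-- A nonzero bracket with `r = 0` is that of Case 7 in suitable generators. -/
theorem EquivCase.of_r_eq_zero {B : Bracket 2} {a : Tensor22 2} (hB : IsDoublePoisson B)
    (h : HasTensors B 0 a) (hB0 : B ≠ 0) : EquivCase B := by
  -- some column of the first factor of `a` is a nonzero vector, which becomes the generator `u`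
  have ⟨l, α, β, hw⟩ : ∃ l α β, ¬(a 0 l α β = 0 ∧ a 1 l α β = 0) := by
    by_contra! hw
    have : a = 0 := by
      ext p q α β
      fin_cases p
      · exact (hw q α β).1
      · exact (hw q α β).2
    subst this
    exact hB0 (h.eq_zero hB)
  have ⟨x, hx0, hx1⟩ : ∃ x : GL (Fin 2) ℂ, x 0 0 = a 0 l α β ∧ x 0 1 = a 1 l α β := by
    by_cases h0 : a 0 l α β = 0
    · refine ⟨Matrix.GeneralLinearGroup.mkOfDetNeZero !![a 0 l α β, a 1 l α β; 1, 0] ?_, rfl, rfl⟩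
      simpa [Matrix.det_fin_two] using fun h1 => hw ⟨h0, h1⟩
    · refine ⟨Matrix.GeneralLinearGroup.mkOfDetNeZero !![a 0 l α β, a 1 l α β; 0, 1] ?_, rfl, rfl⟩
      simpa [Matrix.det_fin_two] using h0
  have heq := h.tensorEquations hB
  obtain ⟨B', r', a', hB', h', hBB', hr, ha⟩ := exists_transport hB h x
  obtain rfl := hr.eq_zero
  -- the first factors of `a` multiply to zero, so that they annihilate the new generator `u`
  have ha0 (p q j : Fin 2) : a' p q 0 j = 0 := by
    have := eq_zero_of_sum_mul_mul (h := x) (c := fun p q => a' p q 0 j) fun s t => by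
      rw [← ha 0 j s t]
      have e0 := heq.eq_two_zero_one α β 0 t s l
      have e1 := heq.eq_two_zero_one α β 1 t s l
      simp only [Fin.sum_univ_two, Pi.zero_apply, hx0, hx1] at e0 e1 ⊢
      linear_combination -x j 0 * e0 - x j 1 * e1
    exact congrFun (congrFun this p) q
  obtain ⟨c, hc⟩ : ∃ c : ℂ, a' = c • caseA 6 :=
    ⟨_, (h'.tensorEquations hB').eq_smul_caseA_six fun p q j => ha0 p q j⟩
  subst hc
  have hc0 : c ≠ 0 := by
    rintro rfl
    rw [zero_smul] at h'
    exact hBB'.ne_zero hB0 (h'.eq_zero hB')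
  -- the constant is removed by scaling the generator `v`
  obtain ⟨d, hd⟩ := IsAlgClosed.exists_pow_nat_eq c⁻¹ (n := 2) two_pos
  have hd0 : d ≠ 0 := by
    rintro rfl
    exact inv_ne_zero hc0 (by simpa using hd.symm)
  obtain ⟨B'', r'', a'', hB'', h'', hBB'', hr', ha'⟩ := exists_transport hB' h'
    (Matrix.GeneralLinearGroup.mkOfDetNeZero !![1, 0; 0, d] (by simpa [Matrix.det_fin_two]))
  obtain rfl := hr'.eq_zero
  have hcd : c * d ^ 2 = 1 := by rw [hd, mul_inv_cancel₀ hc0]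
  have : a'' = caseA 6 := by
    refine ha'.unique fun i j s t => ?_
    fin_cases i <;> fin_cases j <;> fin_cases s <;> fin_cases t <;>
      simp [Matrix.GeneralLinearGroup.mkOfDetNeZero, caseA, unitTensor]
    linear_combination hcd
  subst this
  exact ⟨6, B'', ⟨hB'', h''⟩, hBB'.trans hBB''⟩

theorem equivCase {B : Bracket 2} (hB : IsDoublePoisson B) (hQ : IsQuadratic B) (hB0 : B ≠ 0) :
    EquivCase B := by
  obtain ⟨r, a, -, h⟩ := hQ
  have heq := h.tensorEquations hB
  have hd (σ α : Fin 2) : r σ σ α α = 0 := by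
    have := heq.skew σ σ α α
    linear_combination this / 2
  have h0 : r 0 0 1 0 = -r 0 0 0 1 := heq.skew _ _ _ _
  have h1 : r 1 1 1 0 = -r 1 1 0 1 := heq.skew _ _ _ _
  have h2 (α β : Fin 2) : r 1 0 α β = -r 0 1 β α := heq.skew _ _ _ _
  have hzero (h3 : r 0 0 0 1 = 0) (h4 : r 1 1 0 1 = 0) (h5 : r 0 1 0 1 = 0)
      (h6 : r 0 1 1 0 = 0) (h7 : r 0 1 0 0 = 0) (h8 : r 0 1 1 1 = 0) : EquivCase B := by
    have : r = 0 := by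
      ext p q α β
      fin_cases p <;> fin_cases q <;> fin_cases α <;> fin_cases β <;> simp [*]
    subst this
    exact EquivCase.of_r_eq_zero hB h hB0
  -- In the first type, `r` maps `x_α ⊗ x_β` to `q α β • (x₁ ⊗ x₂ - x₂ ⊗ x₁)` with a symmetric form
  -- `q` of rank one, and `u` has to span the kernel of `q`. In the second type, `r` maps `x₁ ⊗ x₂`
  -- to `q = -r (x₂ ⊗ x₁)` with a symmetric tensor `q` of rank one, and `v ⊗ v` has to span `q`.
  rcases heq.r_cases with ⟨h3, h4, h5, h6⟩ | ⟨h3, h4, h5, h6⟩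
  · by_cases h7 : r 0 1 1 1 = 0
    · have h8 : r 0 1 0 1 = 0 := by simpa [h7] using h6
      by_cases h9 : r 0 1 0 0 = 0
      · exact hzero h3 h4 h8 (h5.trans h8) h9 h7
      · refine EquivCase.of_tensorRel_caseR_zero hB h
          (Matrix.GeneralLinearGroup.mkOfDetNeZero !![0, r 0 1 0 0; 1, 0]
            (by simpa [Matrix.det_fin_two])) fun i j s t => ?_
        fin_cases i <;> fin_cases j <;> fin_cases s <;> fin_cases t <;>
          simp [Matrix.GeneralLinearGroup.mkOfDetNeZero, caseR, unitTensor, *]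
    · refine EquivCase.of_tensorRel_caseR_zero hB h
        (Matrix.GeneralLinearGroup.mkOfDetNeZero !![-r 0 1 1 1, r 0 1 0 1; 0, 1]
          (by simpa [Matrix.det_fin_two])) fun i j s t => ?_
      fin_cases i <;> fin_cases j <;> fin_cases s <;> fin_cases t <;>
        simp [Matrix.GeneralLinearGroup.mkOfDetNeZero, caseR, unitTensor, hd, h0, h1, h2, h3, h4,
          h5]
      · linear_combination -r 0 1 1 1 * h6
      · linear_combination r 0 1 1 1 * h6
      all_goals ring
  · by_cases h7 : r 1 1 0 1 = 0
    · have h8 : r 0 1 0 1 = 0 := by simpa [h7] using h6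
      by_cases h9 : r 0 0 0 1 = 0
      · exact hzero h9 h7 h8 (by rw [h5, h8, neg_zero]) h3 h4
      · refine EquivCase.of_tensorRel_caseR_three hB h
          (Matrix.GeneralLinearGroup.mkOfDetNeZero !![0, (r 0 0 0 1)⁻¹; 1, 0]
            (by simpa [Matrix.det_fin_two])) fun i j s t => ?_
        fin_cases i <;> fin_cases j <;> fin_cases s <;> fin_cases t <;>
          simp [Matrix.GeneralLinearGroup.mkOfDetNeZero, caseR, unitTensor, *]
    · refine EquivCase.of_tensorRel_caseR_three hB h
        (Matrix.GeneralLinearGroup.mkOfDetNeZero !![-1, 0; r 0 1 0 1, r 1 1 0 1]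
          (by simpa [Matrix.det_fin_two])) fun i j s t => ?_
      fin_cases i <;> fin_cases j <;> fin_cases s <;> fin_cases t <;>
        simp [Matrix.GeneralLinearGroup.mkOfDetNeZero, caseR, unitTensor, hd, h0, h1, h2, h3, h4,
          h5]
      · linear_combination -h6
      · ring
      · linear_combination -h6
      all_goals ring

end DoublePoisson

end

open DoublePoisson in
theorem mainTheorem1 :
    -- each of the seven cases defines exactly one double Poisson bracket on `ℂ⟨u, v⟩`
    (∀ i : Fin 7, ∃! B : Bracket 2, IsDoublePoisson B ∧ HasTensors B (caseR i) (caseA i)) ∧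
    -- it is quadratic and nonzero, with the listed values on the generators
    (∀ (i : Fin 7) (B : Bracket 2), IsDoublePoisson B → HasTensors B (caseR i) (caseA i) →
      IsQuadratic B ∧ B ≠ 0 ∧
        ∀ α β : Fin 2, B (gen α ⊗ₜ[ℂ] gen β) = caseValue i α β) ∧
    -- every nonzero quadratic double Poisson bracket is equivalent to exactly one of the seven
    (∀ B : Bracket 2, IsDoublePoisson B → IsQuadratic B → B ≠ 0 →
      ∃! i : Fin 7, ∃ B' : Bracket 2,
        (IsDoublePoisson B' ∧ HasTensors B' (caseR i) (caseA i)) ∧ LinEquivalent B B') := by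
  refine ⟨fun i => ?_, fun i B hB h => ?_, fun B hB hQ hB0 => ?_⟩
  · obtain ⟨B, hB, h⟩ := exists_case i
    refine ⟨B, ⟨hB, h⟩, fun B' hB' => ?_⟩
    exact hB'.1.isDoubleBracket.ext_generators hB.isDoubleBracket fun α β =>
      (hB'.2 α β).trans (h α β).symm
  · refine ⟨⟨_, _, h.isSkew hB.isDoubleBracket, h⟩, ?_, fun α β =>
      (h α β).trans (sum_case_eq_caseValue i α β)⟩
    rintro rfl
    have hr : caseR i = 0 := by
      ext p q α β
      simpa using (h.wordCoeff₂_one_one p q α β).symm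
    have ha := h.wordCoeff₂_two_zero 0 0 1 1
    rw [(caseR_eq_zero_iff i).1 hr] at ha
    simp [caseA, unitTensor] at ha
  · obtain ⟨i, B', hB', hBB'⟩ := equivCase hB hQ hB0
    refine ⟨i, ⟨B', hB', hBB'⟩, ?_⟩
    rintro j ⟨B'', hB'', hBB''⟩
    exact case_injective hB''.2 hB'.2 (hBB''.symm.trans hBB')
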